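/- Let $d\ge 3$ and $T>0$. Write $\mathbb R^d_\pm=\{\pm x_1>0\}$, $x'=(-x_1,x_2,\dots,x_d)$, and let $c_d>0$ be the constant with $c_d\,\mathrm{div}(x|x|^{-d})=\delta_0$. For $f$ on $(0,T)\times\overline{\mathbb R^d_+}\times\mathbb R^d$ let $\rho^o_t(x)=\int f_t(x,v)\,dv$ for $x_1\ge 0$, $\rho^o_t(x)=-\rho^o_t(x')$ for $x_1<0$, and $E_t(x)=c_d\int_{\mathbb R^d}\rho^o_t(y)\frac{x-y}{|x-y|^d}\,dy$. For $g$ on $(0,T)\times\mathbb R^{2d}$ let $\tilde\rho_t(x)=\pm\int g_t(x,v)\,dv$ and $\tilde E_t(x)=\pm c_d\int_{\mathbb R^d}\tilde\rho_t(y)\frac{x-y}{|x-y|^d}\,dy$, with sign $+$ for $x_1\ge0$ and $-$ for $x_1<0$. Put $b_t(x,v)=(v,E_t(x))$, $\tilde b_t(x,v)=(v,\tilde E_t(x))$. Let $\gamma_T^{+}=\{(t,x,v):0<t<T,\ x_1=0,\ v_1>0\}$, with measure $dt\,d\sigma_x\,dv$, where $\sigma$ is the surface measure of $\{x_1=0\}$,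 and let $\mathcal T_T$ be the set of functions $\varphi$ that are $C^1$ up to the boundary on $[0,\infty)\times\overline{\mathbb R^d_+}\times\mathbb R^d$ and whose support (relative to this set) is compact, lies in $\{t<T\}$ and does not meet $\{t=0,\,x_1=0\}\cup\{x_1=0,\,v_1=0\}$. For $\beta\in C^1\cap L^\infty(\mathbb R)$ and functions $f$, $f_0$, $h$, let $(\mathrm A_{\beta})$ be the condition that for every $\varphi\in\mathcal T_T$ $$\int_{\mathbb R^d_+\times\mathbb R^d}\varphi_0\,\beta(f_0)\,dx\,dv+\int_0^T\!\!\int_{\mathbb R^d_+\times\mathbb R^d}[\partial_t\varphi_t+\nabla_{x,v}\varphi_t\cdot b_t]\,\beta(f_t)\,dx\,dv\,dt+\int_{\gamma_T^+}v_1\big(\varphi_t(x,v)-\varphi_t(x,v')\big)h\,dt\,d\sigma_x\,dv=0 .$$ A function $f\in L^\infty((0,T);L^1(\mathbb R^d_+\times\mathbb R^d))$ is a renormalized solution of Problem A starting from the measurable function $f_0$ if for every $\beta\in C^1\cap L^\infty(\mathbb R)$ there is $h=f^+_\beta\in L^\infty_{\rm loc}(\gamma^+_T)$ with $(\mathrm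 A_\beta)$. A function $g\in L^\infty((0,T);L^1(\mathbb R^{2d}))$ that is even with respect to $(x_1,v_1)$, i.e. $g_t(x',v')=g_t(x,v)$ a.e., is a renormalized solution of Problem B starting from the measurable function $g_0$ if for every $\beta\in C^1\cap L^\infty(\mathbb R)$ and every $\phi\in C^1_c([0,T)\times\mathbb R^{2d})$ $$\int_{\mathbb R^{2d}}\phi_0\,\beta(g_0)\,dx\,dv+\int_0^T\!\!\int_{\mathbb R^{2d}}[\partial_t\phi_t+\nabla_{x,v}\phi_t\cdot\tilde b_t]\,\beta(g_t)\,dx\,dv\,dt=0 .$$ (i) If $f$ is a renormalized solution of Problem A starting from $f_0$, then its even extension $g_t(x,v)=f_t(x,v)$ for $x_1\ge0$, $g_t(x,v)=f_t(x',v')$ for $x_1<0$, is a renormalized solution of Problem B starting from the even extension of $f_0$; if $f\ge0$, then $g\ge0$. (ii) If $g$ is a renormalized solution of Problem B starting from $g_0$, then the restriction $f$ of $g$ to $(0,T)\times\overline{\mathbb R^d_+}\times\mathbb R^d$ is a renormalized solution of Problem A starting from the restriction $f_0$ of $g_0$. Moreover, for every $\beta\in C^1\cap L^\infty(\mathbb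 R)$ the trace can be chosen bounded: there is $h=f^+_\beta\in L^\infty(\gamma^+_T)$ with $(\mathrm A_\beta)$. The even extension of $f$ coincides with $g$ almost everywhere. -/

import Mathlib

open MeasureTheory Set

noncomputable section

namespace VlasovHalf

/-- The space `ℝ^d` with `d = n + 1` (Euclidean norm, Lebesgue measure); the coordinate that the
mathematics calls `x₁` is `x 0`. -/
abbrev Sp (n : ℕ) : Type := EuclideanSpace ℝ (Fin (n + 1))

/-- Phase space, with points `(x, v)`. -/
abbrev Phase (n : ℕ) : Type := Sp n × Sp n

/-- Time and phase space, with points `(t, x, v)`. -/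
abbrev TPhase (n : ℕ) : Type := ℝ × Phase n

/-- The reflection `x ↦ x' = (-x₁, x₂, …, x_d)`. -/
def mirror {n : ℕ} (x : Sp n) : Sp n := WithLp.toLp 2 (Function.update x.ofLp 0 (-(x 0)))

/-- The reflection `(x, v) ↦ (x', v')` of phase space. -/
def mirrorPhase {n : ℕ} (z : Phase n) : Phase n := (mirror z.1, mirror z.2)

/-- The open half-space `{x₁ > 0}`, as a set of positions. -/
def halfSpace (n : ℕ) : Set (Sp n) := {x | 0 < x 0}

/-- The closed half-space `{x₁ ≥ 0}`. -/
def closedHalfSpace (n : ℕ) : Set (Sp n) := {x | 0 ≤ x 0}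

/-- The points `(x, v)` with `x₁ > 0`. -/
def halfPhase (n : ℕ) : Set (Phase n) := halfSpace n ×ˢ univ

/-- The points `(x, v)` with `x₁ ≥ 0`. -/
def closedHalfPhase (n : ℕ) : Set (Phase n) := closedHalfSpace n ×ˢ univ

/-- Even extension with respect to `(x₁, v₁)`; only the values of `u` on `{x₁ ≥ 0}` are used. -/
def evenExt {n : ℕ} (u : Phase n → ℝ) (z : Phase n) : ℝ :=
  if 0 ≤ z.1 0 then u z else u (mirrorPhase z)

/-- The even extension with respect to `(x₁, v₁)` of a time-dependent function. -/
def evenExtT {n : ℕ} (f : TPhase n → ℝ) (p : TPhase n) : ℝ :=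
  evenExt (fun z => f (p.1, z)) p.2

/-! ### The electric fields -/

/-- The constant `c_d` with `c_d div (x / |x|^d) = δ₀`: the reciprocal of the area
`d · |B₁|` of the unit sphere of `ℝ^d`, `d = n + 1`. -/
def cDim (n : ℕ) : ℝ := 1 / (((n : ℝ) + 1) * (volume (Metric.ball (0 : Sp n) 1)).toReal)

/-- `x ↦ c_d ∫ ρ(y) (x - y) / |x - y|^d dy`. -/
def coulomb {n : ℕ} (ρ : Sp n → ℝ) (x : Sp n) : Sp n :=
  cDim n • ∫ y, (ρ y / ‖x - y‖ ^ (n + 1)) • (x - y)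

/-- The density of Problem A: `∫ f dv` for `x₁ ≥ 0`, extended to `x₁ < 0` as an odd function. -/
def rhoA {n : ℕ} (f : TPhase n → ℝ) (t : ℝ) (x : Sp n) : ℝ :=
  if 0 ≤ x 0 then ∫ v, f (t, x, v) else - ∫ v, f (t, mirror x, v)

/-- The electric field of Problem A. -/
def fieldA {n : ℕ} (f : TPhase n → ℝ) (t : ℝ) (x : Sp n) : Sp n := coulomb (rhoA f t) x

/-- The density of Problem B: `∫ g dv` for `x₁ ≥ 0` and `-∫ g dv` for `x₁ < 0`. -/
def rhoB {n : ℕ} (g : TPhase n → ℝ) (t : ℝ) (x : Sp n) : ℝ :=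
  if 0 ≤ x 0 then ∫ v, g (t, x, v) else - ∫ v, g (t, x, v)

/-- The electric field of Problem B, with opposite signs in the two half-spaces. -/
def fieldB {n : ℕ} (g : TPhase n → ℝ) (t : ℝ) (x : Sp n) : Sp n :=
  if 0 ≤ x 0 then coulomb (rhoB g t) x else - coulomb (rhoB g t) x

/-- The vector field `b_t(x, v) = (v, E_t(x))`. -/
def vecField {n : ℕ} (E : ℝ → Sp n → Sp n) (p : TPhase n) : Phase n := (p.2.2, E p.1 p.2.1)

/-! ### The boundary of the half-space -/

/-- The parametrisation `y ↦ (0, y)` of `{x₁ = 0}` by `ℝ^(d-1)`. -/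
def bdryEmb (n : ℕ) (y : EuclideanSpace ℝ (Fin n)) : Sp n := WithLp.toLp 2 (Fin.cons 0 y.ofLp)

theorem continuous_bdryEmb (n : ℕ) : Continuous (bdryEmb n) := by
  unfold bdryEmb
  refine (PiLp.continuous_toLp 2 _).comp (continuous_pi fun i => ?_)
  refine Fin.cases ?_ (fun j => ?_) i
  · simpa using continuous_const
  · simp only [Fin.cons_succ]
    fun_prop

/-- The surface measure of `{x₁ = 0}`, as a measure on `ℝ^d`. -/
def surfMeasure (n : ℕ) : Measure (Sp n) := (volume : Measure (EuclideanSpace ℝ (Fin n))).map (bdryEmb n)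

/-- `dt dσ_x dv`. -/
def bdryMeasure (n : ℕ) : Measure (TPhase n) :=
  (volume : Measure ℝ).prod ((surfMeasure n).prod (volume : Measure (Sp n)))

/-- `γ⁺_T = {(t, x, v) : 0 < t < T, x₁ = 0, v₁ > 0}`; the inward normal is `e₁`. -/
def gammaPlus (n : ℕ) (T : ℝ) : Set (TPhase n) :=
  {p | 0 < p.1 ∧ p.1 < T ∧ p.2.1 0 = 0 ∧ 0 < p.2.2 0}

/-- `h ∈ L^∞(γ⁺_T)`. -/
def TraceBdd {n : ℕ} (T : ℝ) (h : TPhase n → ℝ) : Prop :=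
  MemLp h ⊤ ((bdryMeasure n).restrict (gammaPlus n T))

/-- `h ∈ L^∞_loc(γ⁺_T)`. -/
def TraceLocBdd {n : ℕ} (T : ℝ) (h : TPhase n → ℝ) : Prop :=
  ∀ K : Set (TPhase n), IsCompact K → K ⊆ gammaPlus n T →
    MemLp h ⊤ ((bdryMeasure n).restrict K)

/-! ### Test functions and renormalized solutions -/

/-- `β ∈ C¹ ∩ L^∞(ℝ)`. -/
def Renormalizer (β : ℝ → ℝ) : Prop := ContDiff ℝ 1 β ∧ ∃ C : ℝ, ∀ s, |β s| ≤ C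

/-- The class `𝒯_T` for the half-space: `C¹` functions of `(t, x, v)`, up to `t = 0` and `x₁ = 0`,
whose support in `[0, ∞) × {x₁ ≥ 0} × ℝ^d` is compact, lies in `t < T`, and meets neither
`{t = 0, x₁ = 0}` nor `{x₁ = 0, v₁ = 0}`. They are given as restrictions of compactly supported
`C¹` functions on the whole space; what happens at `t < 0` or at `x₁ < 0` is irrelevant. -/
structure IsTestA {n : ℕ} (T : ℝ) (φ : TPhase n → ℝ) : Prop where
  contDiff : ContDiff ℝ 1 φ
  compact : HasCompactSupport φ
  supp : ∀ p ∈ tsupport φ, 0 ≤ p.1 → 0 ≤ p.2.1 0 →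
    p.1 < T ∧ ¬ (p.1 = 0 ∧ p.2.1 0 = 0) ∧ ¬ (p.2.1 0 = 0 ∧ p.2.2 0 = 0)

/-- The class `C¹_c([0, T) × ℝ^{2d})`, given as restrictions to `t ≥ 0`. -/
structure IsTestB {n : ℕ} (T : ℝ) (φ : TPhase n → ℝ) : Prop where
  contDiff : ContDiff ℝ 1 φ
  compact : HasCompactSupport φ
  supp : ∀ p ∈ tsupport φ, 0 ≤ p.1 → p.1 < T

/-- `u ∈ L^∞((0, T); L¹(S))`. -/
def LinftyL1 {n : ℕ} (T : ℝ) (S : Set (Phase n)) (u : TPhase n → ℝ) : Prop :=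
  AEStronglyMeasurable u (volume.restrict (Ioo 0 T ×ˢ S)) ∧
  ∃ C : NNReal, ∀ᵐ t ∂(volume.restrict (Ioo (0 : ℝ) T)), ∫⁻ z in S, ‖u (t, z)‖ₑ ≤ C

/-- The transport equation with field `b` and specular reflection in the half-space, in the sense
of the Green formula: `u` is the unknown, `u₀` its initial value and `h` its trace on `γ⁺_T`.
Here `fderiv ℝ φ p (1, b p)` is `∂_t φ + b · ∇_{x,v} φ`. -/
def WeakHalf {n : ℕ} (T : ℝ) (b : TPhase n → Phase n) (u₀ : Phase n → ℝ) (u h : TPhase n → ℝ) :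
    Prop :=
  ∀ φ : TPhase n → ℝ, IsTestA T φ →
    (∫ z in halfPhase n, φ (0, z) * u₀ z)
      + (∫ p in Ioo 0 T ×ˢ halfPhase n, fderiv ℝ φ p (1, b p) * u p)
      + (∫ p in gammaPlus n T,
          p.2.2 0 * (φ p - φ (p.1, p.2.1, mirror p.2.2)) * h p ∂(bdryMeasure n)) = 0

/-- The transport equation with field `b` in the whole space, in the sense of distributions. -/
def WeakWhole {n : ℕ} (T : ℝ) (b : TPhase n → Phase n) (u₀ : Phase n → ℝ) (u : TPhase n → ℝ) :
    Prop :=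
  ∀ φ : TPhase n → ℝ, IsTestB T φ →
    (∫ z, φ (0, z) * u₀ z) + (∫ p in Ioo 0 T ×ˢ univ, fderiv ℝ φ p (1, b p) * u p) = 0

/-- `f` is a renormalized solution of Problem A, in the class `L^∞((0, T); L¹)`, starting from
`f₀`. -/
structure IsSolA {n : ℕ} (T : ℝ) (f₀ : Phase n → ℝ) (f : TPhase n → ℝ) : Prop where
  linftyL1 : LinftyL1 T (halfPhase n) f
  meas_init : AEStronglyMeasurable f₀ (volume.restrict (halfPhase n))
  weak : ∀ β : ℝ → ℝ, Renormalizer β → ∃ h : TPhase n → ℝ, TraceLocBdd T h ∧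
    WeakHalf T (vecField (fieldA f)) (β ∘ f₀) (β ∘ f) h

/-- `g` is a renormalized solution of Problem B, in the class `L^∞((0, T); L¹)`, starting from
`g₀`. -/
structure IsSolB {n : ℕ} (T : ℝ) (g₀ : Phase n → ℝ) (g : TPhase n → ℝ) : Prop where
  linftyL1 : LinftyL1 T univ g
  meas_init : AEStronglyMeasurable g₀ volume
  even : ∀ᵐ p ∂(volume.restrict (Ioo 0 T ×ˢ (univ : Set (Phase n)))),
    g (p.1, mirrorPhase p.2) = g p
  weak : ∀ β : ℝ → ℝ, Renormalizer β →
    WeakWhole T (vecField (fieldB g)) (β ∘ g₀) (β ∘ g)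

end VlasovHalf

end

open VlasovHalf

open Filter Topology

namespace VlasovHalf
variable {n : ℕ}

/-! Let `r` be the reflection of `(x₁, v₁)`. An odd density produces a field with `E(x') = -E(x)'`,
so changing the sign of `E` on `{x₁ < 0}` makes the transport field equivariant under `r`. Folding
the lower half onto the upper one then shows that the whole-space formulation for even extensions,
tested with `φ`, is the half-space formulation tested with `φ + φ ∘ r` (`form_univ_evenExt`).
Problem B therefore says that the half-space functional `form` vanishes on symmetric test functions.
Problem A says more: it prescribes `form` on all its test functions through a boundary term, which
vanishes on symmetric ones.

From A to B the only obstacle is that the test functions of A avoid `{t = 0, x₁ = 0}` and `{x₁ = 0,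
v₁ = 0}`. These sets have codimension two. A cutoff at scale `1/K` has transport derivative of order
`K` times a locally integrable function, on a set thin in two directions. One direction absorbs the
factor `K` and the other sends the integral to zero (`tendsto_integral_cornerCut`). Local
integrability of `E` suffices, and it follows from integrating the kernel `|z|^(1-d)` against a
density bounded in `L¹`, uniformly in time.

From B to A a trace has to be constructed. A cutoff vanishing for `x₁ ≤ 1/K` makes the reflected
part of the test function invisible in the half-space, so `form` vanishes on the truncated function.
The derivative of the cutoff then tests averages of the solution over a layer of thickness `O(1/K)`.
These averages are bounded, hence have a weak limit `h₀`, and `form φ = -∫ v₁ φ h₀` over the entire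
boundary (`exists_trace`). Antisymmetrising in `φ` and `φ ∘ r`, which is allowed because `form`
vanishes on their sum, and folding `v₁ < 0` onto `v₁ > 0` yields the specular term with trace
`(h₀(v) + h₀(v')) / 2`.

The initial datum in Problem B is not assumed even. Evenness of `β ∘ g₀` is a consequence of the
weak formulation (`ae_even_of_weak`). -/

/-! ### The reflection of position, phase space and time-phase space. -/

theorem mirror_apply_zero (x : Sp n) : mirror x 0 = -x 0 := by simp [mirror]

theorem mirror_apply_succ (x : Sp n) (i : Fin n) : mirror x i.succ = x i.succ := by
  simp [mirror, Fin.succ_ne_zero]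

theorem mirror_mirror (x : Sp n) : mirror (mirror x) = x := by
  ext i
  refine Fin.cases ?_ (fun j => ?_) i
  · simp [mirror_apply_zero]
  · simp [mirror_apply_succ]

/-- The reflection as a linear isometry. -/
noncomputable def mirrorIso (n : ℕ) : Sp n ≃ₗᵢ[ℝ] Sp n where
  toLinearEquiv := LinearEquiv.ofInvolutive
    { toFun := mirror
      map_add' := fun x y => by
        ext i
        refine Fin.cases ?_ (fun j => ?_) i
        · simp [mirror_apply_zero]; ring
        · simp [mirror_apply_succ]
      map_smul' := fun c x => by
        ext i
        refine Fin.cases ?_ (fun j => ?_) i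
        · simp [mirror_apply_zero]
        · simp [mirror_apply_succ] } mirror_mirror
  norm_map' := fun x => by
    change ‖mirror x‖ = ‖x‖
    simp [EuclideanSpace.norm_eq, Fin.sum_univ_succ, mirror_apply_zero, mirror_apply_succ]

@[simp] theorem mirrorIso_apply (x : Sp n) : mirrorIso n x = mirror x := rfl

theorem mirror_sub (x y : Sp n) : mirror (x - y) = mirror x - mirror y := (mirrorIso n).map_sub x y
theorem mirror_smul (c : ℝ) (x : Sp n) : mirror (c • x) = c • mirror x := (mirrorIso n).map_smul c x
theorem norm_mirror (x : Sp n) : ‖mirror x‖ = ‖x‖ := (mirrorIso n).norm_map x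
theorem continuous_mirror : Continuous (mirror (n := n)) := (mirrorIso n).continuous

theorem measurePreserving_mirror : MeasurePreserving (mirror (n := n)) :=
  (mirrorIso n).measurePreserving

/-- The reflection of phase space as a continuous linear equivalence. -/
noncomputable def mirrorPhaseL (n : ℕ) : Phase n ≃L[ℝ] Phase n :=
  (mirrorIso n).toContinuousLinearEquiv.prodCongr (mirrorIso n).toContinuousLinearEquiv

@[simp] theorem mirrorPhaseL_apply (z : Phase n) : mirrorPhaseL n z = mirrorPhase z := rfl

/-- The reflection in `(x₁, v₁)` of time and phase space. -/
def mirrorT (p : TPhase n) : TPhase n := (p.1, mirrorPhase p.2)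

/-- The reflection of time and phase space as a continuous linear equivalence. -/
noncomputable def mirrorTL (n : ℕ) : TPhase n ≃L[ℝ] TPhase n :=
  (ContinuousLinearEquiv.refl ℝ ℝ).prodCongr (mirrorPhaseL n)

@[simp] theorem mirrorTL_apply (p : TPhase n) : mirrorTL n p = mirrorT p := rfl

theorem mirrorPhase_mirrorPhase (z : Phase n) : mirrorPhase (mirrorPhase z) = z := by
  simp [mirrorPhase, mirror_mirror]

theorem mirrorT_mirrorT (p : TPhase n) : mirrorT (mirrorT p) = p := by
  simp [mirrorT, mirrorPhase_mirrorPhase]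

theorem measurePreserving_mirrorPhase : MeasurePreserving (mirrorPhase (n := n)) :=
  measurePreserving_mirror.prod measurePreserving_mirror

theorem measurePreserving_mirrorT : MeasurePreserving (mirrorT (n := n)) :=
  (MeasurePreserving.id volume).prod measurePreserving_mirrorPhase

theorem measurableEmbedding_mirrorPhase : MeasurableEmbedding (mirrorPhase (n := n)) :=
  (mirrorPhaseL n).toHomeomorph.measurableEmbedding

theorem measurableEmbedding_mirrorT : MeasurableEmbedding (mirrorT (n := n)) :=
  (mirrorTL n).toHomeomorph.measurableEmbedding

theorem measurableEmbedding_mirror : MeasurableEmbedding (mirror (n := n)) :=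
  (mirrorIso n).toHomeomorph.measurableEmbedding

/-! ### Splitting off the first coordinate -/

/-- The splitting `x ↦ (x₁, (x₂, …, x_d))`. -/
def splitEquiv (n : ℕ) : Sp n ≃ᵐ ℝ × EuclideanSpace ℝ (Fin n) :=
  ((MeasurableEquiv.toLp 2 (Fin (n + 1) → ℝ)).symm.trans
    (MeasurableEquiv.piFinSuccAbove (fun _ => ℝ) 0)).trans
    ((MeasurableEquiv.refl ℝ).prodCongr (MeasurableEquiv.toLp 2 (Fin n → ℝ)))

theorem measurePreserving_splitEquiv : MeasurePreserving (splitEquiv n) :=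
  (((MeasurePreserving.id volume).prod (PiLp.volume_preserving_toLp (Fin n))).comp
    (volume_preserving_piFinSuccAbove (fun _ => ℝ) 0)).comp (PiLp.volume_preserving_ofLp _)

theorem splitEquiv_fst (x : Sp n) : (splitEquiv n x).1 = x 0 := rfl

/-- The point with coordinates `(s, y)`. -/
def consPt (s : ℝ) (y : EuclideanSpace ℝ (Fin n)) : Sp n := WithLp.toLp 2 (Fin.cons s y.ofLp)

theorem splitEquiv_symm (q : ℝ × EuclideanSpace ℝ (Fin n)) :
    (splitEquiv n).symm q = consPt q.1 q.2 := by
  apply (splitEquiv n).injective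
  rw [MeasurableEquiv.apply_symm_apply]
  rfl

theorem consPt_zero (y : EuclideanSpace ℝ (Fin n)) : consPt 0 y = bdryEmb n y := rfl

@[simp] theorem consPt_apply_zero (s : ℝ) (y : EuclideanSpace ℝ (Fin n)) : consPt s y 0 = s := rfl

theorem continuous_consPt : Continuous fun q : ℝ × EuclideanSpace ℝ (Fin n) => consPt q.1 q.2 := by
  unfold consPt
  refine (PiLp.continuous_toLp 2 _).comp (continuous_pi fun i => ?_)
  refine Fin.cases ?_ (fun j => ?_) i
  · simpa using continuous_fst
  · simp only [Fin.cons_succ]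
    fun_prop

theorem norm_consPt_sub (s : ℝ) (y : EuclideanSpace ℝ (Fin n)) :
    ‖consPt s y - consPt 0 y‖ = |s| := by
  rw [EuclideanSpace.norm_eq, Fin.sum_univ_succ]
  simp [consPt, Real.sqrt_sq_eq_abs]

theorem mirror_bdryEmb (y : EuclideanSpace ℝ (Fin n)) : mirror (bdryEmb n y) = bdryEmb n y := by
  ext i
  refine Fin.cases ?_ (fun j => ?_) i
  · rw [mirror_apply_zero]; simp [bdryEmb]
  · rw [mirror_apply_succ]

theorem volume_coord_zero : volume {x : Sp n | x 0 = 0} = 0 := by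
  have : {x : Sp n | x 0 = 0} = splitEquiv n ⁻¹' ({0} ×ˢ univ) := by
    ext x; simp [splitEquiv_fst]
  rw [this, measurePreserving_splitEquiv.measure_preimage
    ((measurableSet_singleton 0).prod .univ).nullMeasurableSet, Measure.volume_eq_prod,
    Measure.prod_prod]
  simp

/-! ### Weak compactness of bounded sequences of functions -/

/-- Multiplication by the weight `w` places bounded functions in a ball of `L²`, which is weakly
compact. The limit is taken along an ultrafilter rather than a subsequence, so it identifies only
those limits of integrals that are already known to exist, which is all the construction of the
trace needs. -/
theorem exists_weak_limit {X : Type*} [MeasurableSpace X] {m : Measure X} [SigmaFinite m]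
    {w : X → ℝ} (hw : ∀ x, 0 < w x) (hwm : Measurable w) (hw2 : MemLp w 2 m)
    {H : ℕ → X → ℝ} (hH : ∀ k, AEStronglyMeasurable (H k) m) {C : ℝ} (hC : ∀ k x, |H k x| ≤ C) :
    ∃ h : X → ℝ, Measurable h ∧ (∀ x, |h x| ≤ C) ∧ ∀ ψ : X → ℝ,
      MemLp (fun x => ψ x / w x) 2 m → ∀ l : ℝ,
        Tendsto (fun k => ∫ x, ψ x * H k x ∂m) atTop (𝓝 l) → l = ∫ x, ψ x * h x ∂m := by
  have hWm : ∀ k, MemLp (fun x => H k x * w x) 2 m := fun k =>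
    MemLp.of_le_mul (c := C) hw2 ((hH k).mul hwm.aestronglyMeasurable) (Eventually.of_forall fun x => by
      rw [norm_mul, Real.norm_eq_abs]
      exact mul_le_mul_of_nonneg_right (hC k x) (norm_nonneg _))
  let W : ℕ → Lp ℝ 2 m := fun k => (hWm k).toLp _
  have hWn : ∀ k, ‖W k‖ ≤ C * ‖hw2.toLp w‖ := fun k => by
    refine Lp.norm_le_mul_norm_of_ae_le_mul ?_
    filter_upwards [(hWm k).coeFn_toLp, hw2.coeFn_toLp] with x h1 h2
    rw [h1, h2, norm_mul, Real.norm_eq_abs]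
    exact mul_le_mul_of_nonneg_right (hC k x) (norm_nonneg _)
  let S : ℕ → WeakDual ℝ (Lp ℝ 2 m) := fun k =>
    StrongDual.toWeakDual (InnerProductSpace.toDual ℝ (Lp ℝ 2 m) (W k))
  obtain ⟨S', -, hS'⟩ := (WeakDual.isCompact_closedBall (𝕜 := ℝ) (E := Lp ℝ 2 m) 0
    (C * ‖hw2.toLp w‖)).ultrafilter_le_nhds ((hyperfilter ℕ).map S) (by
      rw [le_principal_iff, Ultrafilter.coe_map, Filter.mem_map]
      refine Filter.univ_mem' fun k => ?_
      simpa [S] using hWn k)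
  have hlim : ∀ φ : Lp ℝ 2 m, Tendsto (fun k => inner ℝ (W k) φ) (hyperfilter ℕ) (𝓝 (S' φ)) :=
    fun φ => ((WeakDual.eval_continuous φ).tendsto S').comp hS'
  let V : Lp ℝ 2 m := (InnerProductSpace.toDual ℝ (Lp ℝ 2 m)).symm (WeakDual.toStrongDual S')
  have hV : ∀ φ, S' φ = inner ℝ V φ := fun φ =>
    (InnerProductSpace.toDual_symm_apply (𝕜 := ℝ) (x := φ) (y := WeakDual.toStrongDual S')).symm
  have hset : ∀ A, MeasurableSet A → m A < ⊤ → ∀ f : Lp ℝ 2 m, IntegrableOn f A m := fun A _ hA f =>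
    have : IsFiniteMeasure (m.restrict A) := ⟨by simpa using hA⟩
    ((Lp.memLp f).restrict A).integrable (by norm_num)
  have hwset : ∀ A, MeasurableSet A → m A < ⊤ → IntegrableOn w A m := fun A _ hA =>
    have : IsFiniteMeasure (m.restrict A) := ⟨by simpa using hA⟩
    (hw2.restrict A).integrable (by norm_num)
  have hlimA : ∀ A (hA : MeasurableSet A) (hA' : m A < ⊤),
      Tendsto (fun k => ∫ x in A, H k x * w x ∂m) (hyperfilter ℕ) (𝓝 (∫ x in A, V x ∂m)) := by
    intro A hA hA'
    have := hlim (indicatorConstLp 2 hA hA'.ne 1)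
    rw [hV, real_inner_comm, L2.inner_indicatorConstLp_one] at this
    refine this.congr fun k => ?_
    rw [real_inner_comm, L2.inner_indicatorConstLp_one]
    exact integral_congr_ae (ae_restrict_of_ae (hWm k).coeFn_toLp)
  -- The pointwise bounds on `H k * w` survive in the weak limit because they can be read off from
  -- integrals over sets of finite measure.
  have hup : ∀ᵐ x ∂m, 0 ≤ C * w x - V x := by
    refine ae_nonneg_of_forall_setIntegral_nonneg_of_sigmaFinite
      (fun A hA hA' => ((hwset A hA hA').const_mul C).sub (hset A hA hA' V)) fun A hA hA' => ?_
    rw [integral_sub ((hwset A hA hA').const_mul C) (hset A hA hA' V), sub_nonneg]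
    refine le_of_tendsto (hlimA A hA hA') (Eventually.of_forall fun k => ?_)
    have : IsFiniteMeasure (m.restrict A) := ⟨by simpa using hA'⟩
    exact integral_mono (((hWm k).restrict A).integrable (by norm_num))
      ((hwset A hA hA').const_mul C) fun x =>
        mul_le_mul_of_nonneg_right (le_of_abs_le (hC k x)) (hw x).le
  have hlo : ∀ᵐ x ∂m, 0 ≤ V x + C * w x := by
    refine ae_nonneg_of_forall_setIntegral_nonneg_of_sigmaFinite
      (fun A hA hA' => (hset A hA hA' V).add ((hwset A hA hA').const_mul C)) fun A hA hA' => ?_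
    rw [integral_add (hset A hA hA' V) ((hwset A hA hA').const_mul C), ← neg_le_iff_add_nonneg,
      ← integral_neg]
    refine ge_of_tendsto (hlimA A hA hA') (Eventually.of_forall fun k => ?_)
    have : IsFiniteMeasure (m.restrict A) := ⟨by simpa using hA'⟩
    refine integral_mono ((hwset A hA hA').const_mul C).neg
      (((hWm k).restrict A).integrable (by norm_num)) fun x => ?_
    have := mul_le_mul_of_nonneg_right (neg_le_of_abs_le (hC k x)) (hw x).le
    simpa using this
  -- `V / w` is bounded by `C` only almost everywhere; the truncation changes it on a null set and
  -- makes the bound hold everywhere.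
  refine ⟨fun x => max (-C) (min C (V x / w x)), ?_, fun x => ?_, fun ψ hψ l hl => ?_⟩
  · exact measurable_const.max (measurable_const.min ((Lp.stronglyMeasurable V).measurable.div hwm))
  · have : 0 ≤ C := (abs_nonneg _).trans (hC 0 x)
    exact abs_le.2 ⟨le_max_left _ _, max_le (by linarith) (min_le_left _ _)⟩
  · have h1 : ∀ k, inner ℝ (W k) (hψ.toLp _) = ∫ x, ψ x * H k x ∂m := fun k => by
      rw [L2.inner_def]
      refine integral_congr_ae ?_
      filter_upwards [(hWm k).coeFn_toLp, hψ.coeFn_toLp] with x h1 h2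
      rw [h1, h2]
      have := (hw x).ne'
      simp only [RCLike.inner_apply, conj_trivial]
      field_simp
    have h2 : inner ℝ V (hψ.toLp _) = ∫ x, ψ x * max (-C) (min C (V x / w x)) ∂m := by
      rw [L2.inner_def]
      refine integral_congr_ae ?_
      filter_upwards [hup, hlo, hψ.coeFn_toLp] with x h1 h2 h3
      have hx := hw x
      have h4 : V x / w x ≤ C := (div_le_iff₀ hx).2 (by linarith)
      have h5 : -C ≤ V x / w x := (le_div_iff₀ hx).2 (by linarith)
      rw [h3, min_eq_right h4, max_eq_right h5]
      simp only [RCLike.inner_apply, conj_trivial]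
      field_simp
    rw [← h2, ← hV]
    refine tendsto_nhds_unique (hl.mono_left Nat.hyperfilter_le_atTop) ?_
    exact (hlim (hψ.toLp _)).congr h1

/-! ### The Coulomb field -/

theorem restrict_prod_univ {X Y : Type*} [MeasureSpace X] [MeasureSpace Y]
    [SFinite (volume : Measure X)] [SFinite (volume : Measure Y)] (I : Set X) :
    (volume : Measure (X × Y)).restrict (I ×ˢ univ) = (volume.restrict I).prod volume := by
  rw [Measure.volume_eq_prod, ← Measure.prod_restrict, Measure.restrict_univ]

/-- The kernel `z / |z|^d`. -/
noncomputable def kern (z : Sp n) : Sp n := (1 / ‖z‖ ^ (n + 1)) • z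

theorem coulomb_eq_kern (ρ : Sp n → ℝ) (x : Sp n) :
    coulomb ρ x = cDim n • ∫ y, ρ y • kern (x - y) := by
  simp [coulomb, kern, smul_smul, div_eq_mul_inv]

theorem measurable_kern : Measurable (kern (n := n)) := by
  unfold kern; fun_prop

theorem norm_kern (z : Sp n) : ‖kern z‖ ≤ 1 * ‖z‖ ^ (-(n : ℝ)) := by
  rcases eq_or_ne z 0 with rfl | hz
  · simp only [kern, smul_zero, norm_zero]; positivity
  · have : 0 < ‖z‖ := norm_pos_iff.2 hz
    rw [kern, norm_smul, norm_div, norm_one, norm_pow, norm_norm, Real.rpow_neg this.le,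
      Real.rpow_natCast, pow_succ]
    apply le_of_eq
    field_simp

theorem norm_kern_le_one {z : Sp n} (hz : 1 ≤ ‖z‖) : ‖kern z‖ ≤ 1 := by
  refine (norm_kern z).trans ?_
  rw [one_mul]
  exact Real.rpow_le_one_of_one_le_of_nonpos hz (by simp)

theorem integrableOn_kern : IntegrableOn (kern (n := n)) (Metric.ball 0 1) := by
  refine integrableOn_ball_of_norm_le_rpow (C := 1) (α := n) (by simp) (by simp)
    (Eventually.of_forall norm_kern) measurable_kern.aestronglyMeasurable

/-- The kernel has a singularity of order `n` in dimension `n + 1`, hence is integrable on the unit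
ball, and it is at most `1` outside. Translation invariance makes the bound uniform in `y`. -/
theorem exists_lintegral_kern_le (n : ℕ) (R : ℝ) : ∃ K : ENNReal, K ≠ ⊤ ∧ ∀ y : Sp n,
    ∫⁻ x in Metric.ball 0 R, ‖kern (x - y)‖ₑ ≤ K := by
  refine ⟨(∫⁻ z in Metric.ball (0 : Sp n) 1, ‖kern z‖ₑ) + volume (Metric.ball (0 : Sp n) R),
    ENNReal.add_ne_top.2 ⟨(integrableOn_kern (n := n)).2.ne, measure_ball_lt_top.ne⟩, fun y => ?_⟩
  have hm : Measurable fun z : Sp n => (Metric.ball (0 : Sp n) 1).indicator (fun z => ‖kern z‖ₑ) z :=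
    measurable_kern.enorm.indicator measurableSet_ball
  calc ∫⁻ x in Metric.ball 0 R, ‖kern (x - y)‖ₑ
      ≤ ∫⁻ x in Metric.ball 0 R,
          ((Metric.ball (0 : Sp n) 1).indicator (fun z => ‖kern z‖ₑ) (x - y) + 1) := by
        refine lintegral_mono fun x => ?_
        by_cases h : x - y ∈ Metric.ball (0 : Sp n) 1
        · simp [indicator_of_mem h]
        · rw [indicator_of_notMem h, zero_add]
          rw [← ofReal_norm, ENNReal.ofReal_le_one]
          exact norm_kern_le_one (by simpa using h)
    _ = (∫⁻ x in Metric.ball 0 R,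
          (Metric.ball (0 : Sp n) 1).indicator (fun z => ‖kern z‖ₑ) (x - y))
          + volume (Metric.ball (0 : Sp n) R) := by
        rw [lintegral_add_right _ measurable_const, setLIntegral_one]
    _ ≤ _ := by
        refine add_le_add ?_ le_rfl
        refine (setLIntegral_le_lintegral _ _).trans ?_
        rw [lintegral_sub_right_eq_self
          (fun z => (Metric.ball (0 : Sp n) 1).indicator (fun z => ‖kern z‖ₑ) z),
          lintegral_indicator measurableSet_ball]

/-- Tonelli reduces the claim to the uniform local bound on the kernel. The constant does not depend
on `ρ`, which is what gives integrability in time later. -/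
theorem exists_lintegral_coulomb_le (n : ℕ) (R : ℝ) : ∃ K : ENNReal, K ≠ ⊤ ∧ ∀ ρ : Sp n → ℝ,
    AEMeasurable ρ → ∫⁻ x in Metric.ball 0 R, ‖coulomb ρ x‖ₑ ≤ K * ∫⁻ y, ‖ρ y‖ₑ := by
  obtain ⟨K, hK, hKy⟩ := exists_lintegral_kern_le n R
  refine ⟨‖cDim n‖ₑ * K, ENNReal.mul_ne_top enorm_ne_top hK, fun ρ hρ => ?_⟩
  have hm : AEMeasurable (fun q : Sp n × Sp n => ‖ρ q.2‖ₑ * ‖kern (q.1 - q.2)‖ₑ)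
      ((volume.restrict (Metric.ball 0 R)).prod volume) :=
    (hρ.comp_quasiMeasurePreserving Measure.quasiMeasurePreserving_snd).enorm.mul
      (measurable_kern.comp (measurable_fst.sub measurable_snd)).enorm.aemeasurable
  calc ∫⁻ x in Metric.ball 0 R, ‖coulomb ρ x‖ₑ
      ≤ ∫⁻ x in Metric.ball 0 R, ‖cDim n‖ₑ * ∫⁻ y, ‖ρ y‖ₑ * ‖kern (x - y)‖ₑ := by
        refine lintegral_mono fun x => ?_
        rw [coulomb_eq_kern, enorm_smul]
        gcongr
        refine (enorm_integral_le_lintegral_enorm _).trans (le_of_eq ?_)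
        simp only [enorm_smul]
    _ = ‖cDim n‖ₑ * ∫⁻ y, ∫⁻ x in Metric.ball 0 R, ‖ρ y‖ₑ * ‖kern (x - y)‖ₑ := by
        rw [lintegral_const_mul' _ _ enorm_ne_top, lintegral_lintegral_swap hm]
    _ ≤ ‖cDim n‖ₑ * ∫⁻ y, ‖ρ y‖ₑ * K := by
        gcongr with y
        rw [lintegral_const_mul' _ _ enorm_ne_top]
        gcongr
        exact hKy y
    _ = _ := by
        rw [lintegral_mul_const' _ _ hK]; ring

theorem stronglyMeasurable_coulomb {ρ : ℝ × Sp n → ℝ} (hρ : StronglyMeasurable ρ) :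
    StronglyMeasurable fun q : ℝ × Sp n => coulomb (fun y => ρ (q.1, y)) q.2 := by
  simp only [coulomb_eq_kern]
  have hk : StronglyMeasurable fun p : (ℝ × Sp n) × Sp n => kern (p.1.2 - p.2) := (measurable_kern.comp (by fun_prop : Measurable fun p : (ℝ × Sp n) × Sp n => p.1.2 - p.2)
    ).stronglyMeasurable
  have h : StronglyMeasurable fun q : ℝ × Sp n => ∫ y, ρ (q.1, y) • kern (q.2 - y) :=
    StronglyMeasurable.integral_prod_right
      (f := fun (q : ℝ × Sp n) (y : Sp n) => ρ (q.1, y) • kern (q.2 - y))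
      ((hρ.comp_measurable (by fun_prop)).smul hk)
  exact h.const_smul (cDim n)

theorem coulomb_congr {ρ ρ' : Sp n → ℝ} (h : ρ =ᵐ[volume] ρ') : coulomb ρ = coulomb ρ' := by
  funext x
  rw [coulomb_eq_kern, coulomb_eq_kern]
  congr 1
  refine integral_congr_ae ?_
  filter_upwards [h] with y hy
  rw [hy]

theorem kern_mirror (z : Sp n) : kern (mirror z) = mirror (kern z) := by
  rw [kern, kern, norm_mirror, mirror_smul]

/-- Substitute `y ↦ y'`: the kernel commutes with the reflection and the odd density contributes the
sign. The identity holds at every `x`, although oddness is needed only almost everywhere. -/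
theorem coulomb_mirror {ρ : Sp n → ℝ} (h : ∀ᵐ y, ρ (mirror y) = -ρ y) (x : Sp n) :
    coulomb ρ (mirror x) = -mirror (coulomb ρ x) := by
  rw [coulomb_eq_kern, coulomb_eq_kern, mirror_smul, ← smul_neg]
  congr 1
  rw [← measurePreserving_mirror.integral_comp measurableEmbedding_mirror]
  have hL := (mirrorIso n).toContinuousLinearEquiv.integral_comp_comm (μ := volume)
    (fun y => ρ y • kern (x - y))
  simp only [LinearIsometryEquiv.coe_toContinuousLinearEquiv, mirrorIso_apply] at hL
  rw [← hL, ← integral_neg]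
  refine integral_congr_ae ?_
  filter_upwards [h] with y hy
  rw [hy, ← mirror_sub, kern_mirror, mirror_smul, neg_smul]

/-! ### The densities -/

theorem rhoB_congr {T : ℝ} {g g' : TPhase n → ℝ}
    (h : ∀ᵐ p ∂(volume.restrict (Ioo 0 T ×ˢ (univ : Set (Phase n)))), g p = g' p) :
    ∀ᵐ t ∂(volume.restrict (Ioo (0 : ℝ) T)), rhoB g t =ᵐ[volume] rhoB g' t := by
  rw [restrict_prod_univ] at h
  filter_upwards [Measure.ae_ae_of_ae_prod h] with t ht
  rw [Measure.volume_eq_prod] at ht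
  filter_upwards [Measure.ae_ae_of_ae_prod ht] with x hx
  simp only [rhoB, integral_congr_ae hx]

theorem rhoA_eq_rhoB (f : TPhase n → ℝ) : rhoA f = rhoB (evenExtT f) := by
  funext t x
  by_cases hx : 0 ≤ x 0
  · simp [rhoA, rhoB, hx, evenExtT, evenExt]
  · simp only [rhoA, rhoB, hx, evenExtT, evenExt, if_false, mirrorPhase]
    rw [← measurePreserving_mirror.integral_comp measurableEmbedding_mirror]

/-- Oddness can fail on `{x₁ = 0}`, where the definition keeps the unreflected value; this is a null
set. -/
theorem rhoA_mirror (f : TPhase n → ℝ) (t : ℝ) : ∀ᵐ x, rhoA f t (mirror x) = -rhoA f t x := by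
  have : ∀ᵐ x : Sp n, x 0 ≠ 0 := by
    rw [ae_iff]; simpa using volume_coord_zero (n := n)
  filter_upwards [this] with x hx
  rcases lt_or_gt_of_ne hx with h | h
  · simp [rhoA, mirror_apply_zero, h.not_ge, h.le]
  · simp [rhoA, mirror_apply_zero, h.not_ge, h.le, mirror_mirror]

theorem fieldA_mirror (f : TPhase n → ℝ) (t : ℝ) (x : Sp n) :
    fieldA f t (mirror x) = -mirror (fieldA f t x) := coulomb_mirror (rhoA_mirror f t) x

theorem fieldB_evenExtT (f : TPhase n → ℝ) (t : ℝ) (x : Sp n) :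
    fieldB (evenExtT f) t x = if 0 ≤ x 0 then fieldA f t x else -fieldA f t x := by
  rw [fieldB, fieldA, rhoA_eq_rhoB]

theorem fieldB_congr {T : ℝ} {g g' : TPhase n → ℝ}
    (h : ∀ᵐ p ∂(volume.restrict (Ioo 0 T ×ˢ (univ : Set (Phase n)))), g p = g' p) :
    ∀ᵐ t ∂(volume.restrict (Ioo (0 : ℝ) T)), fieldB g t = fieldB g' t := by
  filter_upwards [rhoB_congr h] with t ht
  funext x
  rw [fieldB, fieldB, coulomb_congr ht]

theorem integrableOn_coulomb_rhoB {T : ℝ} {g : TPhase n → ℝ} (hg : LinftyL1 T univ g) (R : ℝ) :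
    IntegrableOn (fun q : ℝ × Sp n => coulomb (rhoB g q.1) q.2)
      (Ioo 0 T ×ˢ Metric.ball 0 R) := by
  obtain ⟨hgm, C, hC⟩ := hg
  rw [restrict_prod_univ] at hgm
  -- Measurability of the field in `(t, x)` is proved for a strongly measurable representative; for
  -- almost every `t` it produces the same field, since the integral ignores null sets of densities.
  obtain ⟨g', hg', hgg'⟩ := hgm
  have hρm : StronglyMeasurable fun q : ℝ × Sp n => rhoB g' q.1 q.2 := by
    have h1 : StronglyMeasurable fun q : ℝ × Sp n => ∫ v, g' (q.1, q.2, v) :=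
      StronglyMeasurable.integral_prod_right
        (f := fun (q : ℝ × Sp n) (v : Sp n) => g' (q.1, q.2, v))
        (hg'.comp_measurable (by fun_prop))
    exact StronglyMeasurable.ite (measurableSet_le measurable_const (by fun_prop)) h1 h1.neg
  have hE := stronglyMeasurable_coulomb hρm
  have hρ : ∀ᵐ t ∂(volume.restrict (Ioo (0 : ℝ) T)), rhoB g t =ᵐ[volume] rhoB g' t :=
    rhoB_congr (by rw [restrict_prod_univ]; exact hgg')
  have hae : ∀ᵐ q ∂((volume.restrict (Ioo 0 T)).prod (volume.restrict (Metric.ball (0 : Sp n) R))),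
      coulomb (rhoB g' q.1) q.2 = coulomb (rhoB g q.1) q.2 := by
    have := Measure.quasiMeasurePreserving_fst (ν := volume.restrict (Metric.ball (0 : Sp n) R))
      |>.ae hρ
    filter_upwards [this] with q hq
    rw [coulomb_congr hq]
  rw [IntegrableOn, Measure.volume_eq_prod, ← Measure.prod_restrict]
  refine Integrable.congr ?_ hae
  obtain ⟨K, hK, hKρ⟩ := exists_lintegral_coulomb_le n R
  refine ⟨hE.aestronglyMeasurable, ?_⟩
  rw [HasFiniteIntegral, lintegral_prod _ hE.enorm.aemeasurable]
  refine lt_of_le_of_lt (b := ∫⁻ t in Ioo 0 T, K * C) ?_ ?_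
  · refine lintegral_mono_ae ?_
    filter_upwards [hC, Measure.ae_ae_of_ae_prod hgg'] with t ht ht'
    refine (hKρ _ (hρm.measurable.comp measurable_prodMk_left).aemeasurable).trans ?_
    gcongr
    refine le_trans ?_ ht
    have h2 : ∫⁻ z in univ, ‖g (t, z)‖ₑ = ∫⁻ z, ‖g' (t, z)‖ₑ := by
      rw [Measure.restrict_univ]
      exact lintegral_congr_ae (ht'.mono fun z hz => by simp only [hz])
    rw [h2, Measure.volume_eq_prod, lintegral_prod]
    · refine lintegral_mono fun x => ?_
      have : ‖rhoB g' t x‖ₑ = ‖∫ v, g' (t, x, v)‖ₑ := by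
        by_cases hx : 0 ≤ x 0 <;> simp [rhoB, hx]
      refine this.trans_le ?_
      exact enorm_integral_le_lintegral_enorm _
    · exact (hg'.measurable.comp measurable_prodMk_left).enorm.aemeasurable
  · rw [lintegral_const]
    exact ENNReal.mul_lt_top (ENNReal.mul_lt_top hK.lt_top ENNReal.coe_lt_top) (by simp)

/-! ### Folding along a measure preserving involution -/

/-- An involution `r` that preserves `μ` and exchanges `S` with its complement up to a null set. -/
structure IsFold {X : Type*} [MeasurableSpace X] (μ : Measure X) (r : X → X) (S : Set X) :
    Prop where
  mp : MeasurePreserving r μ μ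
  emb : MeasurableEmbedding r
  invol : ∀ x, r (r x) = x
  meas : MeasurableSet S
  disj : Disjoint S (r ⁻¹' S)
  cover : ∀ᵐ x ∂μ, x ∈ S ∪ r ⁻¹' S

namespace IsFold
variable {X : Type*} [MeasurableSpace X] {μ : Measure X} {r : X → X} {S : Set X}

theorem restrict_union (h : IsFold μ r S) : μ.restrict (S ∪ r ⁻¹' S) = μ := by
  have h1 : (S ∪ r ⁻¹' S : Set X) =ᵐ[μ] (univ : Set X) := eventuallyEq_univ.2 h.cover
  rw [Measure.restrict_congr_set h1, Measure.restrict_univ]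

theorem meas' (h : IsFold μ r S) : MeasurableSet (r ⁻¹' S) := h.emb.measurable h.meas

theorem mp_restrict (h : IsFold μ r S) :
    MeasurePreserving r (μ.restrict S) (μ.restrict (r ⁻¹' S)) := by
  have := h.mp.restrict_preimage h.meas'
  rwa [← preimage_comp, show r ∘ r = id from funext h.invol, preimage_id] at this

theorem integral_eq (h : IsFold μ r S) {F : X → ℝ} (hF : Integrable F μ) :
    ∫ x, F x ∂μ = ∫ x in S, (F x + F (r x)) ∂μ := by
  have h1 := setIntegral_union h.disj h.meas' hF.integrableOn hF.integrableOn
  rw [h.restrict_union] at h1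
  have h2 : IntegrableOn (fun x => F (r x)) S μ :=
    ((h.mp.integrable_comp_emb h.emb).2 hF).integrableOn
  rw [h1, integral_add hF.integrableOn h2, h.mp_restrict.integral_comp h.emb]

theorem lintegral_eq (h : IsFold μ r S) (F : X → ENNReal) :
    ∫⁻ x, F x ∂μ = ∫⁻ x in S, F x ∂μ + ∫⁻ x in S, F (r x) ∂μ := by
  have h1 := lintegral_union (μ := μ) (f := F) h.meas' h.disj
  rw [h.restrict_union] at h1
  rw [h1, h.mp_restrict.lintegral_comp_emb h.emb]

theorem aestronglyMeasurable (h : IsFold μ r S) {F : X → ℝ}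
    (h1 : AEStronglyMeasurable F (μ.restrict S))
    (h2 : AEStronglyMeasurable (fun x => F (r x)) (μ.restrict S)) : AEStronglyMeasurable F μ := by
  rw [← h.restrict_union]
  refine aestronglyMeasurable_union_iff.2 ⟨h1, ?_⟩
  exact (h.mp_restrict.aestronglyMeasurable_comp_iff h.emb).1 h2

theorem ae_iff (h : IsFold μ r S) {P : X → Prop} :
    (∀ᵐ x ∂μ, P x) ↔ (∀ᵐ x ∂μ.restrict S, P x) ∧ ∀ᵐ x ∂μ.restrict S, P (r x) := by
  conv_lhs => rw [← h.restrict_union, ae_restrict_union_iff]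
  rw [← h.mp_restrict.map_eq, h.emb.ae_map_iff]

end IsFold

/-! ### The half-space as a fundamental domain of the reflection. -/

theorem measurableSet_halfPhase : MeasurableSet (halfPhase n) :=
  (measurableSet_lt measurable_const (by fun_prop) : MeasurableSet (halfSpace n)).prod .univ

theorem mem_halfPhase {z : Phase n} : z ∈ halfPhase n ↔ 0 < z.1 0 := by
  simp [halfPhase, halfSpace]

theorem mirrorPhase_mem_halfPhase {z : Phase n} : mirrorPhase z ∈ halfPhase n ↔ z.1 0 < 0 := by
  simp [mem_halfPhase, mirrorPhase, mirror_apply_zero]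

theorem ae_coord_ne_zero : ∀ᵐ z : Phase n, z.1 0 ≠ 0 := by
  have : ∀ᵐ x : Sp n, x 0 ≠ 0 := by
    rw [MeasureTheory.ae_iff]; simpa using volume_coord_zero (n := n)
  exact Measure.quasiMeasurePreserving_fst.ae this

theorem isFold_mirrorPhase : IsFold (volume : Measure (Phase n)) mirrorPhase (halfPhase n) where
  mp := measurePreserving_mirrorPhase
  emb := measurableEmbedding_mirrorPhase
  invol := mirrorPhase_mirrorPhase
  meas := measurableSet_halfPhase
  disj := by
    rw [disjoint_left]
    intro z h1 h2
    rw [mem_preimage, mirrorPhase_mem_halfPhase] at h2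
    exact lt_asymm h2 (mem_halfPhase.1 h1)
  cover := by
    filter_upwards [ae_coord_ne_zero] with z hz
    rw [mem_union, mem_preimage, mirrorPhase_mem_halfPhase, mem_halfPhase]
    exact hz.symm.lt_or_gt

theorem ae_restrict_univ_coord_ne_zero (T : ℝ) :
    ∀ᵐ p ∂(volume.restrict (Ioo 0 T ×ˢ (univ : Set (Phase n)))), p.2.1 0 ≠ 0 :=
  ae_restrict_of_ae (Measure.quasiMeasurePreserving_snd.ae ae_coord_ne_zero)

theorem isFold_mirrorT (T : ℝ) :
    IsFold (volume.restrict (Ioo 0 T ×ˢ (univ : Set (Phase n)))) mirrorT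
      (Prod.snd ⁻¹' halfPhase n) where
  mp := by
    have := (measurePreserving_mirrorT (n := n)).restrict_preimage
      (s := Ioo 0 T ×ˢ univ) (measurableSet_Ioo.prod .univ)
    convert! this using 2
  emb := measurableEmbedding_mirrorT
  invol := mirrorT_mirrorT
  meas := measurable_snd measurableSet_halfPhase
  disj := by
    rw [disjoint_left]
    intro p h1 h2
    exact disjoint_left.1 isFold_mirrorPhase.disj h1 h2
  cover := by
    filter_upwards [ae_restrict_univ_coord_ne_zero T] with z hz
    rw [mem_union, mem_preimage, mem_preimage, mem_preimage, mirrorT, mirrorPhase_mem_halfPhase,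
      mem_halfPhase]
    exact hz.symm.lt_or_gt

theorem restrict_restrict_half (T : ℝ) :
    (volume.restrict (Ioo 0 T ×ˢ (univ : Set (Phase n)))).restrict (Prod.snd ⁻¹' halfPhase n)
      = volume.restrict (Ioo 0 T ×ˢ halfPhase n) := by
  rw [Measure.restrict_restrict (measurable_snd measurableSet_halfPhase)]
  congr 1
  ext p; simp [and_comm]

/-! ### The weak formulation as a functional of the test function -/

/-- The left-hand side of the weak formulation in the region `S`, without boundary terms. -/
noncomputable def form (T : ℝ) (S : Set (Phase n)) (E : ℝ → Sp n → Sp n) (u₀ : Phase n → ℝ)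
    (u : TPhase n → ℝ) (φ : TPhase n → ℝ) : ℝ :=
  (∫ z in S, φ (0, z) * u₀ z)
    + ∫ p in Ioo 0 T ×ˢ S, fderiv ℝ φ p (1, vecField E p) * u p

/-- Local integrability of the force and boundedness of the unknowns: what makes `form`
meaningful. -/
structure IsAdmissible (T : ℝ) (S : Set (Phase n)) (E : ℝ → Sp n → Sp n) (u₀ : Phase n → ℝ)
    (u : TPhase n → ℝ) (C : ℝ) : Prop where
  field : ∀ R, IntegrableOn (fun q : ℝ × Sp n => E q.1 q.2) (Ioo 0 T ×ˢ Metric.ball 0 R)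
  meas_init : AEStronglyMeasurable u₀ (volume.restrict S)
  meas : AEStronglyMeasurable u (volume.restrict (Ioo 0 T ×ˢ S))
  bdd_init : ∀ z, |u₀ z| ≤ C
  bdd : ∀ p, |u p| ≤ C

/-- A radius that controls the support of a compactly supported function of `(t, x, v)`. -/
theorem exists_support_radius {F : Type*} [Zero F] {φ : TPhase n → F} (h : HasCompactSupport φ) :
    ∃ R, 0 < R ∧ ∀ p, φ p ≠ 0 → |p.1| < R ∧ ‖p.2.1‖ < R ∧ ‖p.2.2‖ < R := by
  obtain ⟨R, hR, hb⟩ := h.isCompact.isBounded.exists_pos_norm_lt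
  refine ⟨R, hR, fun p hp => ?_⟩
  have := hb p (subset_tsupport _ hp)
  rw [Prod.norm_def, max_lt_iff, Prod.norm_def, max_lt_iff] at this
  exact this

theorem aestronglyMeasurable_field {T : ℝ} {E : ℝ → Sp n → Sp n}
    (hE : ∀ R, IntegrableOn (fun q : ℝ × Sp n => E q.1 q.2) (Ioo 0 T ×ˢ Metric.ball 0 R)) :
    AEStronglyMeasurable (fun q : ℝ × Sp n => E q.1 q.2) (volume.restrict (Ioo 0 T ×ˢ univ)) := by
  have : (Ioo 0 T ×ˢ univ : Set (ℝ × Sp n)) = ⋃ k : ℕ, Ioo 0 T ×ˢ Metric.ball 0 (k : ℝ) := by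
    rw [← prod_iUnion, Metric.iUnion_ball_nat]
  rw [this]
  exact AEStronglyMeasurable.iUnion fun k => (hE k).1

/-- The product of a function of `(t, x)` and a function of `v` is integrable. -/
theorem integrable_prod_velocity {G : ℝ × Sp n → ℝ} {H : Sp n → ℝ} (hG : Integrable G)
    (hH : Integrable H) : Integrable fun p : TPhase n => G (p.1, p.2.1) * H p.2.2 :=
  (volume_preserving_prodAssoc (α₁ := ℝ) (β₁ := Sp n) (γ₁ := Sp n)).symm.integrable_comp_emb
    MeasurableEquiv.prodAssoc.symm.measurableEmbedding |>.2 (hG.mul_prod hH)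

theorem integral_prod_velocity (G : ℝ × Sp n → ℝ) (H : Sp n → ℝ) :
    ∫ p : TPhase n, G (p.1, p.2.1) * H p.2.2 = (∫ q, G q) * ∫ v, H v := by
  rw [← integral_prod_mul]
  exact (volume_preserving_prodAssoc (α₁ := ℝ) (β₁ := Sp n) (γ₁ := Sp n)).symm.integral_comp
    MeasurableEquiv.prodAssoc.symm.measurableEmbedding
    (fun q : (ℝ × Sp n) × Sp n => G q.1 * H q.2)

/-- The field depends on `(t, x)` only and is merely locally integrable there, so the majorant is a
product of an integrable function of `(t, x)` and the indicator of a ball of velocities. Stating it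
for a general compactly supported `A` covers both derivatives of test functions and products with
derivatives of cutoffs. -/
theorem integrable_transport {T : ℝ} {E : ℝ → Sp n → Sp n}
    (hE : ∀ R, IntegrableOn (fun q : ℝ × Sp n => E q.1 q.2) (Ioo 0 T ×ˢ Metric.ball 0 R))
    {A : TPhase n → TPhase n →L[ℝ] ℝ} (hA : Continuous A) (hAc : HasCompactSupport A) :
    IntegrableOn (fun p => A p (1, vecField E p)) (Ioo 0 T ×ˢ univ) := by
  obtain ⟨R, hR, hsupp⟩ := exists_support_radius hAc
  obtain ⟨M, hM⟩ := hA.bounded_above_of_compact_support hAc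
  have hM0 : 0 ≤ M := (norm_nonneg _).trans (hM 0)
  -- On the support of `A`, the vector `(1, v, E)` has norm at most `1 + R + ‖E‖`.
  set G : ℝ × Sp n → ℝ :=
    (Ioo 0 T ×ˢ Metric.ball 0 R).indicator fun q => M * (1 + R + ‖E q.1 q.2‖)
  set H : Sp n → ℝ := (Metric.ball 0 R).indicator fun _ => 1
  have hfin : volume (Ioo 0 T ×ˢ Metric.ball (0 : Sp n) R) ≠ ⊤ := by
    rw [Measure.volume_eq_prod, Measure.prod_prod]
    exact ENNReal.mul_ne_top (by simp) measure_ball_lt_top.ne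
  have hG : Integrable G := by
    refine (integrable_indicator_iff (measurableSet_Ioo.prod measurableSet_ball)).2 ?_
    refine Integrable.const_mul ?_ _
    exact (integrableOn_const hfin).add (hE R).norm
  have hH : Integrable H :=
    (integrable_indicator_iff measurableSet_ball).2 (integrableOn_const measure_ball_lt_top.ne)
  have hmE : AEStronglyMeasurable (fun p : TPhase n => E p.1 p.2.1)
      (volume.restrict (Ioo 0 T ×ˢ univ)) := by
    have h1 := aestronglyMeasurable_field hE
    have h2 : Measure.QuasiMeasurePreserving (fun p : TPhase n => (p.1, p.2.1))
        (volume.restrict (Ioo 0 T ×ˢ univ)) (volume.restrict (Ioo 0 T ×ˢ univ)) := by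
      rw [restrict_prod_univ, restrict_prod_univ]
      exact MeasureTheory.QuasiMeasurePreserving.prodMap
        (Measure.QuasiMeasurePreserving.id _) Measure.quasiMeasurePreserving_fst
    exact h1.comp_quasiMeasurePreserving h2
  refine Integrable.mono' (g := fun p => G (p.1, p.2.1) * H p.2.2)
    (integrable_prod_velocity hG hH).integrableOn ?_ ?_
  · have hv : AEStronglyMeasurable (fun p : TPhase n => p.2.2)
        (volume.restrict (Ioo 0 T ×ˢ univ)) :=
      (by fun_prop : Continuous fun p : TPhase n => p.2.2).aestronglyMeasurable
    exact isBoundedBilinearMap_apply.continuous.comp_aestronglyMeasurable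
      (hA.aestronglyMeasurable.prodMk
        ((aestronglyMeasurable_const (b := (1 : ℝ))).prodMk (hv.prodMk hmE)))
  · refine ae_restrict_of_forall_mem (measurableSet_Ioo.prod .univ) fun p hp => ?_
    by_cases h0 : A p = 0
    · rw [h0]
      simp only [zero_apply, norm_zero]
      exact mul_nonneg (indicator_nonneg (fun q _ => by positivity) _)
        (indicator_nonneg (fun q _ => by positivity) _)
    · obtain ⟨-, hx, hv⟩ := hsupp p h0
      have h1 : G (p.1, p.2.1) = M * (1 + R + ‖E p.1 p.2.1‖) :=
        indicator_of_mem (s := Ioo 0 T ×ˢ Metric.ball (0 : Sp n) R)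
          ⟨hp.1, by simpa using hx⟩ _
      have h2 : H p.2.2 = 1 :=
        indicator_of_mem (s := Metric.ball (0 : Sp n) R) (by simpa using hv) _
      rw [h1, h2, mul_one]
      refine (ContinuousLinearMap.le_opNorm _ _).trans ?_
      refine mul_le_mul (hM p) ?_ (norm_nonneg _) hM0
      rw [Prod.norm_def, Prod.norm_def]
      refine max_le ?_ (max_le ?_ ?_)
      · simp only [norm_one]; linarith [norm_nonneg (E p.1 p.2.1)]
      · change ‖p.2.2‖ ≤ _
        linarith [norm_nonneg (E p.1 p.2.1)]
      · change ‖E p.1 p.2.1‖ ≤ _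
        linarith

namespace IsAdmissible
variable {T : ℝ} {S : Set (Phase n)} {E : ℝ → Sp n → Sp n} {u₀ : Phase n → ℝ}
  {u : TPhase n → ℝ} {C : ℝ}

theorem integrableOn_transport (h : IsAdmissible T S E u₀ u C)
    {A : TPhase n → TPhase n →L[ℝ] ℝ} (hA : Continuous A) (hAc : HasCompactSupport A) :
    IntegrableOn (fun p => A p (1, vecField E p) * u p) (Ioo 0 T ×ˢ S) :=
  ((integrable_transport h.field hA hAc).mono_set (prod_mono_right (subset_univ S))).mul_bdd h.meas
    (Eventually.of_forall h.bdd)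

theorem integrableOn_fderiv (h : IsAdmissible T S E u₀ u C) {φ : TPhase n → ℝ}
    (hφ : ContDiff ℝ 1 φ) (hc : HasCompactSupport φ) :
    IntegrableOn (fun p => fderiv ℝ φ p (1, vecField E p) * u p) (Ioo 0 T ×ˢ S) :=
  h.integrableOn_transport (hφ.continuous_fderiv one_ne_zero) (hc.fderiv ℝ)

theorem integrable_slice {φ : TPhase n → ℝ} (hφ : Continuous φ) (hc : HasCompactSupport φ) :
    Integrable fun z : Phase n => φ (0, z) := by
  refine Continuous.integrable_of_hasCompactSupport (by fun_prop) ?_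
  exact hc.comp_isClosedEmbedding 
    (Isometry.isClosedEmbedding (f := fun z : Phase n => ((0 : ℝ), z))
      fun z w => by simp [Prod.edist_eq])

theorem integrableOn_init (h : IsAdmissible T S E u₀ u C) {φ : TPhase n → ℝ}
    (hφ : Continuous φ) (hc : HasCompactSupport φ) :
    IntegrableOn (fun z => φ (0, z) * u₀ z) S :=
  (integrable_slice hφ hc).integrableOn.mul_bdd h.meas_init (Eventually.of_forall h.bdd_init)

theorem form_add (h : IsAdmissible T S E u₀ u C) {φ ψ : TPhase n → ℝ}
    (hφ : ContDiff ℝ 1 φ) (hc : HasCompactSupport φ) (hψ : ContDiff ℝ 1 ψ)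
    (hc' : HasCompactSupport ψ) :
    form T S E u₀ u (fun p => φ p + ψ p) = form T S E u₀ u φ + form T S E u₀ u ψ := by
  have h1 : ∀ p, fderiv ℝ (fun p => φ p + ψ p) p = fderiv ℝ φ p + fderiv ℝ ψ p := fun p =>
    fderiv_fun_add (hφ.differentiable one_ne_zero p) (hψ.differentiable one_ne_zero p)
  simp only [form, h1, add_apply, add_mul]
  rw [integral_add (h.integrableOn_init hφ.continuous hc) (h.integrableOn_init hψ.continuous hc'),
    integral_add (h.integrableOn_fderiv hφ hc) (h.integrableOn_fderiv hψ hc')]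
  ring

end IsAdmissible

/-! ### Unfolding: the whole-space formulation of even extensions -/

/-- The field on the whole space obtained by changing the sign of `E` on `{x₁ < 0}`. -/
noncomputable def signedField (E : ℝ → Sp n → Sp n) (t : ℝ) (x : Sp n) : Sp n :=
  if 0 ≤ x 0 then E t x else -E t x

theorem evenExtT_of_mem {u : TPhase n → ℝ} {p : TPhase n} (hp : 0 < p.2.1 0) :
    evenExtT u p = u p := by
  simp [evenExtT, evenExt, hp.le]

theorem evenExtT_mirrorT {u : TPhase n → ℝ} {p : TPhase n} (hp : 0 < p.2.1 0) :
    evenExtT u (mirrorT p) = u p := by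
  have : ¬ 0 ≤ mirror p.2.1 0 := by rw [mirror_apply_zero]; linarith
  simp [evenExtT, evenExt, mirrorT, mirrorPhase, this, mirror_mirror]

theorem evenExt_of_mem {u : Phase n → ℝ} {z : Phase n} (hz : 0 < z.1 0) : evenExt u z = u z := by
  simp [evenExt, hz.le]

theorem evenExt_mirrorPhase {u : Phase n → ℝ} {z : Phase n} (hz : 0 < z.1 0) :
    evenExt u (mirrorPhase z) = u z := by
  have : ¬ 0 ≤ mirror z.1 0 := by rw [mirror_apply_zero]; linarith
  simp [evenExt, mirrorPhase, this, mirror_mirror]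

theorem aestronglyMeasurable_evenExt {u : Phase n → ℝ}
    (h : AEStronglyMeasurable u (volume.restrict (halfPhase n))) :
    AEStronglyMeasurable (evenExt u) volume := by
  refine isFold_mirrorPhase.aestronglyMeasurable (h.congr ?_) (h.congr ?_)
  · exact ae_restrict_of_forall_mem measurableSet_halfPhase fun z hz =>
      (evenExt_of_mem (mem_halfPhase.1 hz)).symm
  · exact ae_restrict_of_forall_mem measurableSet_halfPhase fun z hz =>
      (evenExt_mirrorPhase (mem_halfPhase.1 hz)).symm

theorem measurableSet_Ioo_halfPhase (T : ℝ) : MeasurableSet (Ioo 0 T ×ˢ halfPhase n) :=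
  measurableSet_Ioo.prod measurableSet_halfPhase

theorem aestronglyMeasurable_evenExtT {T : ℝ} {u : TPhase n → ℝ}
    (h : AEStronglyMeasurable u (volume.restrict (Ioo 0 T ×ˢ halfPhase n))) :
    AEStronglyMeasurable (evenExtT u) (volume.restrict (Ioo 0 T ×ˢ univ)) := by
  refine (isFold_mirrorT T).aestronglyMeasurable ?_ ?_ <;> rw [restrict_restrict_half] <;>
    refine h.congr ?_
  · exact ae_restrict_of_forall_mem (measurableSet_Ioo_halfPhase T) fun z hz =>
      (evenExtT_of_mem (mem_halfPhase.1 hz.2)).symm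
  · exact ae_restrict_of_forall_mem (measurableSet_Ioo_halfPhase T) fun z hz =>
      (evenExtT_mirrorT (mem_halfPhase.1 hz.2)).symm

theorem contDiff_mirrorT : ContDiff ℝ 1 (mirrorT (n := n)) := (mirrorTL n).contDiff

theorem hasCompactSupport_comp_mirrorT {φ : TPhase n → ℝ} (h : HasCompactSupport φ) :
    HasCompactSupport fun p => φ (mirrorT p) :=
  h.comp_homeomorph (mirrorTL n).toHomeomorph

theorem fderiv_comp_mirrorT {φ : TPhase n → ℝ} (p w : TPhase n) :
    fderiv ℝ (fun p => φ (mirrorT p)) p w = fderiv ℝ φ (mirrorT p) (mirrorT w) := by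
  have := (mirrorTL n).comp_right_fderiv (f := φ) (x := p)
  have h2 : (φ ∘ (mirrorTL n)) = fun p => φ (mirrorT p) := rfl
  rw [h2] at this
  rw [this]
  rfl

namespace IsAdmissible
variable {T : ℝ} {E : ℝ → Sp n → Sp n} {u₀ : Phase n → ℝ} {u : TPhase n → ℝ} {C : ℝ}

theorem extend (h : IsAdmissible T (halfPhase n) E u₀ u C) :
    IsAdmissible T univ (signedField E) (evenExt u₀) (evenExtT u) C where
  field := fun R => by
    have h1 : Measurable fun q : ℝ × Sp n => if 0 ≤ q.2 0 then (1 : ℝ) else -1 :=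
      Measurable.ite (measurableSet_le measurable_const (by fun_prop)) measurable_const
        measurable_const
    refine (Integrable.bdd_smul (h.field R) 1 h1.aestronglyMeasurable
      (Eventually.of_forall fun q => ?_)).congr (Eventually.of_forall fun q => ?_)
    · split_ifs <;> simp
    · simp only [signedField]; split_ifs <;> simp_all
  meas_init := by
    rw [Measure.restrict_univ]; exact aestronglyMeasurable_evenExt h.meas_init
  meas := aestronglyMeasurable_evenExtT h.meas
  bdd_init := fun z => by unfold evenExt; split_ifs <;> exact h.bdd_init _
  bdd := fun z => by unfold evenExtT evenExt; split_ifs <;> exact h.bdd _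

/-- Integrals over the whole space fold onto the half-space, where the even extensions take the same
value at a point and at its reflection. The reflected test function arises because the signed field
is equivariant under the reflection. -/
theorem form_univ_evenExt (h : IsAdmissible T (halfPhase n) E u₀ u C)
    (hE : ∀ t x, E t (mirror x) = -mirror (E t x)) {φ : TPhase n → ℝ}
    (hφ : ContDiff ℝ 1 φ) (hc : HasCompactSupport φ) :
    form T univ (signedField E) (evenExt u₀) (evenExtT u) φ
      = form T (halfPhase n) E u₀ u fun p => φ p + φ (mirrorT p) := by
  rw [form, form]
  congr 1
  · have h1 := h.extend.integrableOn_init hφ.continuous hc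
    rw [IntegrableOn, Measure.restrict_univ] at h1
    rw [Measure.restrict_univ, isFold_mirrorPhase.integral_eq h1]
    refine setIntegral_congr_fun measurableSet_halfPhase fun z hz => ?_
    rw [mem_halfPhase] at hz
    simp only [evenExt_of_mem hz, evenExt_mirrorPhase hz, mirrorT]
    ring
  · rw [(isFold_mirrorT T).integral_eq (h.extend.integrableOn_fderiv hφ hc),
      restrict_restrict_half]
    refine setIntegral_congr_fun (measurableSet_Ioo_halfPhase T) fun p hp => ?_
    have hx := mem_halfPhase.1 hp.2
    have h1 : vecField (signedField E) p = vecField E p := by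
      simp [vecField, signedField, hx.le]
    -- At `x'` the signed field is `-E(x') = E(x)'`, so the whole transport direction at the
    -- reflected point is the reflected direction.
    have h2 : ((1 : ℝ), vecField (signedField E) (mirrorT p)) = mirrorT (1, vecField E p) := by
      have : ¬ 0 ≤ mirror p.2.1 0 := by rw [mirror_apply_zero]; linarith
      simp [vecField, signedField, mirrorT, mirrorPhase, this, hE]
    have h3 : fderiv ℝ (fun p => φ p + φ (mirrorT p)) p
        = fderiv ℝ φ p + fderiv ℝ (fun p => φ (mirrorT p)) p :=
      fderiv_fun_add (hφ.differentiable one_ne_zero p)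
        ((hφ.comp contDiff_mirrorT).differentiable one_ne_zero p)
    simp only [evenExtT_of_mem hx, evenExtT_mirrorT hx, h1, h2, h3, add_apply,
      fderiv_comp_mirrorT]
    ring

/-- The effect on the weak formulation of multiplying the test function by cutoffs that tend
to `1` in the half-space. -/
theorem tendsto_form_mul (h : IsAdmissible T (halfPhase n) E u₀ u C) {φ : TPhase n → ℝ}
    (hφ : ContDiff ℝ 1 φ) (hc : HasCompactSupport φ) {η : ℕ → TPhase n → ℝ}
    (hη : ∀ k, ContDiff ℝ 1 (η k)) (hb : ∀ k p, |η k p| ≤ 1)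
    (hlim : ∀ p : TPhase n, 0 < p.2.1 0 → Tendsto (fun k => η k p) atTop (𝓝 1)) :
    Tendsto (fun k => form T (halfPhase n) E u₀ u (fun p => φ p * η k p)
      - ∫ p in Ioo 0 T ×ˢ halfPhase n, φ p * fderiv ℝ (η k) p (1, vecField E p) * u p)
      atTop (𝓝 (form T (halfPhase n) E u₀ u φ)) := by
  have h0 : ∀ k p, fderiv ℝ (fun p => φ p * η k p) p = φ p • fderiv ℝ (η k) p + η k p • fderiv ℝ φ p :=
    fun k p => fderiv_fun_mul (hφ.differentiable one_ne_zero p)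
      ((hη k).differentiable one_ne_zero p)
  have hI1 := h.integrableOn_fderiv hφ hc
  have hI2 : ∀ k, IntegrableOn
      (fun p => η k p * (fderiv ℝ φ p (1, vecField E p) * u p)) (Ioo 0 T ×ˢ halfPhase n) := fun k =>
    hI1.bdd_mul (hη k).continuous.aestronglyMeasurable (Eventually.of_forall (hb k))
  have hI3 : ∀ k, IntegrableOn
      (fun p => φ p * fderiv ℝ (η k) p (1, vecField E p) * u p) (Ioo 0 T ×ˢ halfPhase n) := fun k => by
    have := h.integrableOn_transport (A := fun p => φ p • fderiv ℝ (η k) p)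
      (hφ.continuous.smul ((hη k).continuous_fderiv one_ne_zero)) hc.smul_right
    simpa only [_root_.smul_apply, smul_eq_mul] using this
  have heq : ∀ k, form T (halfPhase n) E u₀ u (fun p => φ p * η k p)
      - ∫ p in Ioo 0 T ×ˢ halfPhase n, φ p * fderiv ℝ (η k) p (1, vecField E p) * u p
      = (∫ z in halfPhase n, η k (0, z) * (φ (0, z) * u₀ z))
        + ∫ p in Ioo 0 T ×ˢ halfPhase n, η k p * (fderiv ℝ φ p (1, vecField E p) * u p) := by
    intro k
    rw [form, sub_eq_iff_eq_add, add_assoc, ← integral_add (hI2 k) (hI3 k)]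
    congr 1
    · refine integral_congr_ae (Eventually.of_forall fun z => ?_)
      simp only; ring
    · refine integral_congr_ae (Eventually.of_forall fun p => ?_)
      simp only [h0, add_apply, _root_.smul_apply, smul_eq_mul]; ring
  simp only [heq]
  refine Tendsto.add ?_ ?_
  · refine tendsto_integral_of_dominated_convergence _
      (fun k => ?_) (h.integrableOn_init hφ.continuous hc).norm (fun k => ?_) ?_
    · exact ((hη k).continuous.comp (by fun_prop)).aestronglyMeasurable.mul
        (h.integrableOn_init hφ.continuous hc).1
    · refine Eventually.of_forall fun z => ?_
      rw [norm_mul]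
      exact mul_le_of_le_one_left (norm_nonneg _) (hb k _)
    · refine ae_restrict_of_forall_mem measurableSet_halfPhase fun z hz => ?_
      simpa using (hlim (0, z) (mem_halfPhase.1 hz)).mul_const (φ (0, z) * u₀ z)
  · refine tendsto_integral_of_dominated_convergence _
      (fun k => (hI2 k).1) hI1.norm (fun k => ?_) ?_
    · refine Eventually.of_forall fun z => ?_
      rw [norm_mul]
      exact mul_le_of_le_one_left (norm_nonneg _) (hb k _)
    · refine ae_restrict_of_forall_mem (measurableSet_Ioo_halfPhase T) fun p hp => ?_
      simpa using (hlim p (mem_halfPhase.1 hp.2)).mul_const (fderiv ℝ φ p (1, vecField E p) * u p)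

end IsAdmissible

/-! ### Cutoff functions -/

/-- A smooth function that is `0` on `(-∞, 1]` and `1` on `[2, ∞)`. -/
noncomputable def theta (s : ℝ) : ℝ := Real.smoothTransition (s - 1)

theorem contDiff_theta : ContDiff ℝ 1 theta :=
  (Real.smoothTransition.contDiff (n := 1)).comp (contDiff_id.sub contDiff_const)

theorem theta_of_le {s : ℝ} (hs : s ≤ 1) : theta s = 0 :=
  Real.smoothTransition.zero_of_nonpos (by linarith)

theorem theta_of_ge {s : ℝ} (hs : 2 ≤ s) : theta s = 1 :=
  Real.smoothTransition.one_of_one_le (by linarith)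

theorem abs_theta_le (s : ℝ) : |theta s| ≤ 1 := by
  rw [theta, abs_of_nonneg (Real.smoothTransition.nonneg _)]
  exact Real.smoothTransition.le_one _

theorem hasDerivAt_theta (s : ℝ) : HasDerivAt theta (deriv theta s) s :=
  (contDiff_theta.differentiable one_ne_zero s).hasDerivAt

theorem continuous_deriv_theta : Continuous (deriv theta) :=
  contDiff_theta.continuous_deriv le_rfl

theorem deriv_theta_eq_zero {s : ℝ} (hs : s ∉ Icc (1 : ℝ) 2) : deriv theta s = 0 := by
  rw [mem_Icc, not_and_or, not_le, not_le] at hs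
  rcases hs with hs | hs
  · have : theta =ᶠ[𝓝 s] fun _ => 0 := by
      filter_upwards [Iio_mem_nhds hs] with r hr
      exact theta_of_le (le_of_lt hr)
    rw [this.deriv_eq, deriv_const]
  · have : theta =ᶠ[𝓝 s] fun _ => 1 := by
      filter_upwards [Ioi_mem_nhds hs] with r hr
      exact theta_of_ge (le_of_lt hr)
    rw [this.deriv_eq, deriv_const]

theorem exists_abs_deriv_theta_le : ∃ M, 0 ≤ M ∧ ∀ s, |deriv theta s| ≤ M := by
  obtain ⟨M, hM⟩ := continuous_deriv_theta.bounded_above_of_compact_support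
    (HasCompactSupport.intro isCompact_Icc fun s hs => deriv_theta_eq_zero hs)
  exact ⟨M, (norm_nonneg _).trans (hM 0), hM⟩

/-- The integral of an integrable function over a slab that shrinks to a null set tends to `0`. -/
theorem tendsto_integral_slab {X : Type*} [MeasurableSpace X] {μ : Measure X} {G c : X → ℝ}
    (hG : Integrable G μ) (hc : Measurable c) (hc0 : ∀ᵐ x ∂μ, c x ≠ 0) :
    Tendsto (fun k : ℕ => ∫ x, {x | |c x| ≤ 2 / (k + 1 : ℝ)}.indicator G x ∂μ) atTop (𝓝 0) := by
  have hm : ∀ k : ℕ, MeasurableSet {x | |c x| ≤ 2 / (k + 1 : ℝ)} := fun k =>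
    measurableSet_le hc.abs measurable_const
  rw [← integral_zero X ℝ (μ := μ)]
  refine tendsto_integral_of_dominated_convergence (fun x => ‖G x‖)
    (fun k => (hG.indicator (hm k)).1) hG.norm
    (fun k => Eventually.of_forall fun x => norm_indicator_le_norm_self _ _) ?_
  filter_upwards [hc0] with x hx
  refine tendsto_const_nhds.congr' ?_
  have h1 : Tendsto (fun k : ℕ => 2 / (k + 1 : ℝ)) atTop (𝓝 0) := by
    simpa [div_eq_mul_inv] using tendsto_one_div_add_atTop_nhds_zero_nat.const_mul (2 : ℝ)
  filter_upwards [h1.eventually_lt_const (abs_pos.2 hx)] with k hk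
  rw [indicator_of_notMem]
  simpa using hk

/-- The slab inside the ball is contained in an interval of length `2δ` times a ball in the
remaining coordinates. -/
theorem exists_volume_slab_le (n : ℕ) (R : ℝ) : ∃ K : ℝ, ∀ δ, 0 ≤ δ →
    volume.real ({v : Sp n | |v 0| ≤ δ} ∩ Metric.ball 0 R) ≤ K * δ := by
  refine ⟨2 * volume.real (Metric.ball (0 : EuclideanSpace ℝ (Fin n)) R), fun δ hδ => ?_⟩
  have hsub : {v : Sp n | |v 0| ≤ δ} ∩ Metric.ball 0 R
      ⊆ splitEquiv n ⁻¹' (Icc (-δ) δ ×ˢ Metric.ball 0 R) := by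
    rintro v ⟨h1, h2⟩
    refine ⟨abs_le.1 h1, ?_⟩
    rw [mem_ball_zero_iff] at h2 ⊢
    refine lt_of_le_of_lt ?_ h2
    rw [EuclideanSpace.norm_eq, EuclideanSpace.norm_eq, Fin.sum_univ_succ]
    refine Real.sqrt_le_sqrt (le_add_of_nonneg_of_le (sq_nonneg _) (le_of_eq rfl))
  have hm : volume (splitEquiv n ⁻¹' (Icc (-δ) δ ×ˢ Metric.ball 0 R))
      = ENNReal.ofReal (2 * δ) * volume (Metric.ball (0 : EuclideanSpace ℝ (Fin n)) R) := by
    rw [measurePreserving_splitEquiv.measure_preimage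
      (measurableSet_Icc.prod measurableSet_ball).nullMeasurableSet, Measure.volume_eq_prod,
      Measure.prod_prod, Real.volume_Icc]
    ring_nf
  calc volume.real ({v : Sp n | |v 0| ≤ δ} ∩ Metric.ball 0 R)
      ≤ volume.real (splitEquiv n ⁻¹' (Icc (-δ) δ ×ˢ Metric.ball 0 R)) :=
        measureReal_mono hsub (by
          rw [hm]; exact ENNReal.mul_ne_top ENNReal.ofReal_ne_top measure_ball_lt_top.ne)
    _ = _ := by
        rw [Measure.real, hm, ENNReal.toReal_mul, ENNReal.toReal_ofReal (by linarith), Measure.real]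
        ring

/-! ### Removal of the restriction on the support of the test functions -/

/-- The coordinate `x₁` as a linear functional of `(t, x, v)`. -/
noncomputable def posL (n : ℕ) : TPhase n →L[ℝ] ℝ :=
  (EuclideanSpace.proj 0).comp
    ((ContinuousLinearMap.fst ℝ (Sp n) (Sp n)).comp (ContinuousLinearMap.snd ℝ ℝ (Phase n)))

/-- The coordinate `v₁` as a linear functional of `(t, x, v)`. -/
noncomputable def velL (n : ℕ) : TPhase n →L[ℝ] ℝ :=
  (EuclideanSpace.proj 0).comp
    ((ContinuousLinearMap.snd ℝ (Sp n) (Sp n)).comp (ContinuousLinearMap.snd ℝ ℝ (Phase n)))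

theorem posL_apply (p : TPhase n) : posL n p = p.2.1 0 := rfl
theorem velL_apply (p : TPhase n) : velL n p = p.2.2 0 := rfl

/-- A cutoff that vanishes where `K √(a² + b²) ≤ 1`, for linear functionals `a` and `b`. -/
noncomputable def cut (K : ℝ) (a b : TPhase n →L[ℝ] ℝ) (p : TPhase n) : ℝ :=
  theta (K ^ 2 * (a p ^ 2 + b p ^ 2))

theorem hasFDerivAt_cut (K : ℝ) (a b : TPhase n →L[ℝ] ℝ) (p : TPhase n) :
    HasFDerivAt (cut K a b) (deriv theta (K ^ 2 * (a p ^ 2 + b p ^ 2)) •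
      (K ^ 2 • ((2 * a p) • a + (2 * b p) • b))) p := by
  have h1 : HasFDerivAt (fun p => K ^ 2 * (a p ^ 2 + b p ^ 2))
      (K ^ 2 • ((2 * a p) • a + (2 * b p) • b)) p := by
    have := ((a.hasFDerivAt (x := p)).pow 2).add ((b.hasFDerivAt (x := p)).pow 2)
    simpa using this.const_mul (K ^ 2)
  exact (hasDerivAt_theta _).comp_hasFDerivAt p h1

theorem contDiff_cut (K : ℝ) (a b : TPhase n →L[ℝ] ℝ) : ContDiff ℝ 1 (cut K a b) :=
  contDiff_theta.comp (contDiff_const.mul ((a.contDiff.pow 2).add (b.contDiff.pow 2)))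

theorem abs_cut_le (K : ℝ) (a b : TPhase n →L[ℝ] ℝ) (p : TPhase n) : |cut K a b p| ≤ 1 :=
  abs_theta_le _

/-- The derivative of `cut` is supported where both functionals are of size `O(1 / K)`, and is
of size `O(K)` there. -/
theorem abs_fderiv_cut_le {M : ℝ} (hM0 : 0 ≤ M) (hM : ∀ s, |deriv theta s| ≤ M) {K : ℝ} (hK : 0 < K)
    (a b : TPhase n →L[ℝ] ℝ) (p w : TPhase n) :
    |fderiv ℝ (cut K a b) p w| ≤
      if |a p| ≤ 2 / K ∧ |b p| ≤ 2 / K then 4 * M * (|a w| + |b w|) * K else 0 := by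
  rw [(hasFDerivAt_cut K a b p).fderiv]
  simp only [_root_.smul_apply, add_apply, smul_eq_mul]
  -- Where `theta'` can be nonzero, `(K a)²` and `(K b)²` are at most `2`, hence at most `4`. This
  -- confines both functionals to size `2 / K`, and one of the two factors `K` in the derivative is
  -- compensated by `a` or `b`.
  by_cases hs : K ^ 2 * (a p ^ 2 + b p ^ 2) ∈ Icc (1 : ℝ) 2
  · have ha : |a p| ≤ 2 / K := by
      rw [le_div_iff₀ hK, ← abs_of_pos hK, ← abs_mul]
      refine abs_le_of_sq_le_sq ?_ (by norm_num)
      nlinarith [hs.2, sq_nonneg (K * b p)]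
    have hb : |b p| ≤ 2 / K := by
      rw [le_div_iff₀ hK, ← abs_of_pos hK, ← abs_mul]
      refine abs_le_of_sq_le_sq ?_ (by norm_num)
      nlinarith [hs.2, sq_nonneg (K * a p)]
    rw [if_pos ⟨ha, hb⟩, abs_mul]
    have h1 : |K ^ 2 * (2 * a p * a w + 2 * b p * b w)| ≤ 4 * (|a w| + |b w|) * K := by
      rw [abs_mul, abs_of_pos (pow_pos hK 2)]
      calc K ^ 2 * |2 * a p * a w + 2 * b p * b w|
          ≤ K ^ 2 * (2 * (2 / K) * |a w| + 2 * (2 / K) * |b w|) := by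
            gcongr
            refine (abs_add_le _ _).trans ?_
            rw [abs_mul, abs_mul, abs_mul, abs_mul, abs_two]
            gcongr
        _ = _ := by field_simp; ring
    calc _ ≤ M * (4 * (|a w| + |b w|) * K) := mul_le_mul (hM _) h1 (abs_nonneg _) hM0
      _ = _ := by ring
  · rw [deriv_theta_eq_zero hs]
    simp only [zero_mul, abs_zero]
    split_ifs
    · positivity
    · exact le_rfl

/-- The cutoff near `{t = 0, x₁ = 0} ∪ {x₁ = 0, v₁ = 0}`. -/
noncomputable def cornerCut (k : ℕ) (p : TPhase n) : ℝ :=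
  cut (k + 1 : ℝ) (ContinuousLinearMap.fst ℝ ℝ (Phase n)) (posL n) p *
    cut (k + 1 : ℝ) (posL n) (velL n) p

theorem contDiff_cornerCut (k : ℕ) : ContDiff ℝ 1 (cornerCut (n := n) k) :=
  (contDiff_cut _ _ _).mul (contDiff_cut _ _ _)

theorem abs_cornerCut_le (k : ℕ) (p : TPhase n) : |cornerCut k p| ≤ 1 := by
  rw [cornerCut, abs_mul]
  exact mul_le_one₀ (abs_cut_le _ _ _ _) (abs_nonneg _) (abs_cut_le _ _ _ _)

theorem cornerCut_mirrorT (k : ℕ) (p : TPhase n) : cornerCut k (mirrorT p) = cornerCut k p := by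
  simp [cornerCut, cut, posL_apply, velL_apply, mirrorT, mirrorPhase, mirror_apply_zero]

theorem cornerCut_ne_zero {k : ℕ} {p : TPhase n} (h : cornerCut k p ≠ 0) :
    1 ≤ (k + 1 : ℝ) ^ 2 * (p.1 ^ 2 + p.2.1 0 ^ 2) ∧
      1 ≤ (k + 1 : ℝ) ^ 2 * (p.2.1 0 ^ 2 + p.2.2 0 ^ 2) := by
  constructor
  · by_contra hlt
    refine h (mul_eq_zero_of_left ?_ _)
    exact theta_of_le (not_le.1 hlt).le
  · by_contra hlt
    refine h (mul_eq_zero_of_right _ ?_)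
    exact theta_of_le (not_le.1 hlt).le

theorem tendsto_cornerCut {p : TPhase n} (hp : 0 < p.2.1 0) :
    Tendsto (fun k => cornerCut k p) atTop (𝓝 1) := by
  refine tendsto_const_nhds.congr' ?_
  have h1 : Tendsto (fun k : ℕ => (k + 1 : ℝ) ^ 2 * p.2.1 0 ^ 2) atTop atTop :=
    ((tendsto_pow_atTop two_ne_zero).comp
      (tendsto_natCast_atTop_atTop.atTop_add tendsto_const_nhds)).atTop_mul_const (by positivity)
  filter_upwards [h1.eventually_ge_atTop 2] with k hk
  have h2 : ∀ s : ℝ, 0 ≤ (k + 1 : ℝ) ^ 2 * s ^ 2 := fun s => by positivity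
  rw [cornerCut, cut, cut, theta_of_ge, theta_of_ge, one_mul]
  · rw [posL_apply, velL_apply, mul_add]; linarith [h2 (p.2.2 0)]
  · rw [posL_apply, mul_add]
    have := h2 p.1
    simp only [ContinuousLinearMap.coe_fst']
    linarith

theorem isTestA_mul_cornerCut {T : ℝ} {φ : TPhase n → ℝ} (hφ : IsTestB T φ) (k : ℕ) :
    IsTestA T fun p => φ p * cornerCut k p where
  contDiff := hφ.contDiff.mul (contDiff_cornerCut k)
  compact := hφ.compact.mul_right
  supp := fun p hp ht hx => by
    have hp1 : p ∈ tsupport φ := tsupport_mul_subset_left hp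
    have hp2 : p ∈ tsupport (cornerCut (n := n) k) := tsupport_mul_subset_right hp
    have hclosed : IsClosed {p : TPhase n | 1 ≤ (k + 1 : ℝ) ^ 2 * (p.1 ^ 2 + p.2.1 0 ^ 2) ∧
      1 ≤ (k + 1 : ℝ) ^ 2 * (p.2.1 0 ^ 2 + p.2.2 0 ^ 2)} :=
      by
        rw [ofPred_and]
        exact (isClosed_le continuous_const (by fun_prop)).inter
          (isClosed_le continuous_const (by fun_prop))
    -- The lower bounds valid where the cutoff is nonzero are closed conditions, so they persist on
    -- its topological support and exclude the two corner sets.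
    have h3 := closure_minimal (fun p hp => cornerCut_ne_zero hp) hclosed hp2
    refine ⟨hφ.supp p hp1 ht, ?_, ?_⟩
    · rintro ⟨h4, h5⟩
      have := h3.1
      rw [h4, h5] at this
      norm_num at this
    · rintro ⟨h4, h5⟩
      have := h3.2
      rw [h4, h5] at this
      norm_num at this

/-- Each factor of the cutoff is bounded by `1`, so the product rule leaves one term per corner. The
`(t, x₁)` factor sees only the time and position components of the direction, so no force enters it;
the force enters only near `{x₁ = 0, v₁ = 0}`. -/
theorem abs_fderiv_cornerCut_le {M : ℝ} (hM0 : 0 ≤ M) (hM : ∀ s, |deriv theta s| ≤ M) (k : ℕ)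
    (p : TPhase n) (w : Phase n) :
    |fderiv ℝ (cornerCut (n := n) k) p (1, w)| ≤
      (if |p.1| ≤ 2 / (k + 1 : ℝ) ∧ |p.2.1 0| ≤ 2 / (k + 1 : ℝ) then
        4 * M * (1 + ‖w.1‖) * (k + 1) else 0) +
      (if |p.2.1 0| ≤ 2 / (k + 1 : ℝ) ∧ |p.2.2 0| ≤ 2 / (k + 1 : ℝ) then
        4 * M * (‖w.1‖ + ‖w.2‖) * (k + 1) else 0) := by
  have hK : (0 : ℝ) < k + 1 := by positivity
  have h1 := abs_fderiv_cut_le hM0 hM hK (ContinuousLinearMap.fst ℝ ℝ (Phase n)) (posL n) p (1, w)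
  have h2 := abs_fderiv_cut_le hM0 hM hK (posL n) (velL n) p (1, w)
  have h3 : fderiv ℝ (cornerCut (n := n) k) p = _ := fderiv_fun_mul
    ((contDiff_cut (k + 1 : ℝ) (ContinuousLinearMap.fst ℝ ℝ (Phase n)) (posL n)).differentiable
      one_ne_zero p) ((contDiff_cut (k + 1 : ℝ) (posL n) (velL n)).differentiable one_ne_zero p)
  rw [h3]
  simp only [_root_.smul_apply, add_apply, smul_eq_mul]
  refine (abs_add_le _ _).trans ?_
  rw [abs_mul, abs_mul, add_comm]
  have hw1 : |w.1 0| ≤ ‖w.1‖ := PiLp.norm_apply_le w.1 0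
  have hw2 : |w.2 0| ≤ ‖w.2‖ := PiLp.norm_apply_le w.2 0
  refine add_le_add ((mul_le_of_le_one_left (abs_nonneg _) (abs_cut_le _ _ _ _)).trans
    (h1.trans ?_)) ((mul_le_of_le_one_left (abs_nonneg _) (abs_cut_le _ _ _ _)).trans (h2.trans ?_))
  · simp only [ContinuousLinearMap.coe_fst', posL_apply, abs_one]
    split_ifs
    · gcongr
    · exact le_rfl
  · by_cases hif : |p.2.1 0| ≤ 2 / (k + 1 : ℝ) ∧ |p.2.2 0| ≤ 2 / (k + 1 : ℝ)
    · rw [if_pos hif, if_pos (by exact hif)]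
      simp only [posL_apply, velL_apply]
      gcongr
    · rw [if_neg hif, if_neg (by exact hif)]

/-! ### Majorants for the derivative of the corner cutoff. -/

theorem exists_time_weight : ∃ a : ℕ → ℝ → ℝ, (∀ k, Integrable (a k)) ∧ (∀ k t, 0 ≤ a k t) ∧
    (∀ k, ∫ t, a k t = 4) ∧ ∀ (k : ℕ) t, |t| ≤ 2 / (k + 1 : ℝ) → a k t = k + 1 := by
  refine ⟨fun k => (Icc (-(2 / (k + 1 : ℝ))) (2 / (k + 1 : ℝ))).indicator fun _ => (k + 1 : ℝ),
    fun k => (integrable_indicator_iff measurableSet_Icc).2 (integrableOn_const (by simp)),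
    fun k t => indicator_nonneg (fun _ _ => by positivity) _, fun k => ?_,
    fun k t ht => indicator_of_mem (s := Icc (-(2 / (k + 1 : ℝ))) (2 / (k + 1 : ℝ))) (abs_le.1 ht) _⟩
  have hk : (0 : ℝ) < k + 1 := by positivity
  rw [integral_indicator_const _ measurableSet_Icc, Measure.real, Real.volume_Icc,
    ENNReal.toReal_ofReal (by ring_nf; positivity), smul_eq_mul]
  field_simp
  norm_num

/-- Height `k + 1` on a slab of thickness `O(1 / k)`: thinness in `v₁` absorbs the derivative of the
cutoff, leaving a bounded integral. -/
theorem exists_velocity_weight (n : ℕ) (R : ℝ) : ∃ (d : ℕ → Sp n → ℝ) (V : ℝ),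
    (∀ k, Integrable (d k)) ∧ (∀ k v, 0 ≤ d k v) ∧ (∀ k, ∫ v, d k v ≤ V) ∧
    ∀ (k : ℕ) (v : Sp n), |v 0| ≤ 2 / (k + 1 : ℝ) → ‖v‖ < R → d k v = k + 1 := by
  obtain ⟨V, hV⟩ := exists_volume_slab_le n R
  have hmv : ∀ k : ℕ, MeasurableSet ({v : Sp n | |v 0| ≤ 2 / (k + 1 : ℝ)} ∩ Metric.ball 0 R) :=
    fun k => (measurableSet_le (by fun_prop) measurable_const).inter measurableSet_ball
  refine ⟨fun k => ({v : Sp n | |v 0| ≤ 2 / (k + 1 : ℝ)} ∩ Metric.ball 0 R).indicator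
    fun _ => (k + 1 : ℝ), 2 * V, fun k => (integrable_indicator_iff (hmv k)).2 (integrableOn_const
      ((measure_mono inter_subset_right).trans_lt measure_ball_lt_top).ne),
    fun k v => indicator_nonneg (fun _ _ => by positivity) _, fun k => ?_,
    fun k v h1 h2 => indicator_of_mem (s := {v : Sp n | |v 0| ≤ 2 / (k + 1 : ℝ)} ∩ Metric.ball 0 R)
      ⟨h1, by simpa using h2⟩ _⟩
  have hk : (0 : ℝ) < k + 1 := by positivity
  rw [integral_indicator_const _ (hmv k), smul_eq_mul]
  calc _ ≤ V * (2 / (k + 1 : ℝ)) * (k + 1) := by gcongr; exact hV _ (by positivity)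
    _ = _ := by field_simp

theorem exists_slab_weight {X : Type*} [MeasurableSpace X] {μ : Measure X} {G c : X → ℝ}
    (hG : Integrable G μ) (hG0 : ∀ x, 0 ≤ G x) (hc : Measurable c) (hc0 : ∀ᵐ x ∂μ, c x ≠ 0) :
    ∃ s : ℕ → X → ℝ, (∀ k, Integrable (s k) μ) ∧ (∀ k x, 0 ≤ s k x) ∧
      Tendsto (fun k => ∫ x, s k x ∂μ) atTop (𝓝 0) ∧
      ∀ (k : ℕ) x, |c x| ≤ 2 / (k + 1 : ℝ) → s k x = G x :=
  ⟨fun k => {x | |c x| ≤ 2 / (k + 1 : ℝ)}.indicator G,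
    fun _ => hG.indicator (measurableSet_le hc.abs measurable_const),
    fun _ _ => indicator_nonneg (fun _ _ => hG0 _) _, tendsto_integral_slab hG hc hc0,
    fun k _ h => indicator_of_mem (s := {x | |c x| ≤ 2 / (k + 1 : ℝ)}) h _⟩

namespace IsAdmissible
variable {T : ℝ} {E : ℝ → Sp n → Sp n} {u₀ : Phase n → ℝ} {u : TPhase n → ℝ} {C : ℝ}

/-- Near each corner the large factor `k + 1` is integrated over a thin interval of time,
respectively a thin slab of velocities, and stays bounded. The remaining integral over `|x₁| ≤ 2 /
(k + 1)` has a fixed integrable integrand and tends to zero; near `{x₁ = 0, v₁ = 0}` this integrand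
is `1 + ‖E‖`, so no bound on `E` is needed. -/
theorem tendsto_integral_cornerCut (h : IsAdmissible T (halfPhase n) E u₀ u C)
    {φ : TPhase n → ℝ} (hφ : Continuous φ) (hc : HasCompactSupport φ) :
    Tendsto (fun k => ∫ p in Ioo 0 T ×ˢ halfPhase n,
      φ p * fderiv ℝ (cornerCut k) p (1, vecField E p) * u p) atTop (𝓝 0) := by
  obtain ⟨M, hM0, hM⟩ := exists_abs_deriv_theta_le
  obtain ⟨R, hR, hsupp⟩ := exists_support_radius hc
  obtain ⟨Q, hQ⟩ := hφ.bounded_above_of_compact_support hc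
  have hQ0 : 0 ≤ Q := (norm_nonneg _).trans (hQ 0)
  have hC0 : 0 ≤ C := (abs_nonneg _).trans (h.bdd 0)
  set D := Q * C * (4 * M * (1 + R))
  have hD : 0 ≤ D := by positivity
  have hfin : volume (Ioo 0 T ×ˢ Metric.ball (0 : Sp n) R) ≠ ⊤ := by
    rw [Measure.volume_eq_prod, Measure.prod_prod]
    exact ENNReal.mul_ne_top (by simp) measure_ball_lt_top.ne
  have hfin' : volume (Metric.ball (0 : Sp n) R ×ˢ Metric.ball (0 : Sp n) R) ≠ ⊤ := by
    rw [Measure.volume_eq_prod, Measure.prod_prod]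
    exact ENNReal.mul_ne_top measure_ball_lt_top.ne measure_ball_lt_top.ne
  obtain ⟨a, ha, ha0, ha', ham⟩ := exists_time_weight
  obtain ⟨d, V, hd, hd0, hd', hdm⟩ := exists_velocity_weight n R
  obtain ⟨s₁, hs₁, hs₁0, ht₁, hs₁m⟩ := exists_slab_weight (μ := (volume : Measure (Phase n)))
    (c := fun z => z.1 0)
    ((integrable_indicator_iff (measurableSet_ball.prod measurableSet_ball)).2
      (integrableOn_const (C := (1 : ℝ)) hfin'))
    (fun _ => indicator_nonneg (fun _ _ => zero_le_one) _) (by fun_prop) ae_coord_ne_zero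
  obtain ⟨s₂, hs₂, hs₂0, ht₂, hs₂m⟩ := exists_slab_weight (μ := (volume : Measure (ℝ × Sp n)))
    (c := fun q => q.2 0)
    ((integrable_indicator_iff (measurableSet_Ioo.prod measurableSet_ball)).2
      ((integrableOn_const (C := (1 : ℝ)) hfin).add (h.field R).norm))
    (fun _ => indicator_nonneg (fun _ _ => add_nonneg zero_le_one (norm_nonneg _)) _) (by fun_prop)
    (Measure.quasiMeasurePreserving_snd.ae (p := fun x : Sp n => x 0 ≠ 0) (by
      rw [MeasureTheory.ae_iff]; simpa using volume_coord_zero (n := n)))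
  -- The variables separate in each term: time against phase space for the first corner, `(t, x)`
  -- against velocity for the second.
  let B : ℕ → TPhase n → ℝ := fun k p => D * (a k p.1 * s₁ k p.2 + s₂ k (p.1, p.2.1) * d k p.2.2)
  have hB0 : ∀ k p, 0 ≤ B k p := fun k p => mul_nonneg hD
    (add_nonneg (mul_nonneg (ha0 _ _) (hs₁0 _ _)) (mul_nonneg (hs₂0 _ _) (hd0 _ _)))
  have hB : ∀ k, Integrable (B k) := fun k =>
    (((ha k).mul_prod (hs₁ k)).add (integrable_prod_velocity (hs₂ k) (hd k))).const_mul D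
  have hbound : ∀ k, ∀ p ∈ Ioo 0 T ×ˢ halfPhase n,
      ‖φ p * fderiv ℝ (cornerCut k) p (1, vecField E p) * u p‖ ≤ B k p := by
    intro k p hp
    by_cases h0 : φ p = 0
    · rw [h0]; simpa using hB0 k p
    obtain ⟨-, hx, hv⟩ := hsupp p h0
    have hx' : p.2.1 ∈ Metric.ball (0 : Sp n) R := by simpa using hx
    have hv' : p.2.2 ∈ Metric.ball (0 : Sp n) R := by simpa using hv
    have h1 := abs_fderiv_cornerCut_le hM0 hM k p (vecField E p)
    have h2 : (if |p.1| ≤ 2 / (k + 1 : ℝ) ∧ |p.2.1 0| ≤ 2 / (k + 1 : ℝ) then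
        4 * M * (1 + ‖(vecField E p).1‖) * (k + 1) else 0)
        ≤ 4 * M * (1 + R) * (a k p.1 * s₁ k p.2) := by
      split_ifs with hif
      · rw [ham k _ hif.1, hs₁m k _ hif.2, indicator_of_mem (mk_mem_prod hx' hv'), mul_one]
        have : ‖(vecField E p).1‖ ≤ R := hv.le
        gcongr
      · exact mul_nonneg (by positivity) (mul_nonneg (ha0 _ _) (hs₁0 _ _))
    have h3 : (if |p.2.1 0| ≤ 2 / (k + 1 : ℝ) ∧ |p.2.2 0| ≤ 2 / (k + 1 : ℝ) then
        4 * M * (‖(vecField E p).1‖ + ‖(vecField E p).2‖) * (k + 1) else 0)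
        ≤ 4 * M * (1 + R) * (s₂ k (p.1, p.2.1) * d k p.2.2) := by
      split_ifs with hif
      · rw [hdm k _ hif.2 hv, hs₂m k (p.1, p.2.1) hif.1, indicator_of_mem (mk_mem_prod hp.1 hx')]
        simp only [Pi.add_apply]
        have h5 : ‖(vecField E p).1‖ + ‖(vecField E p).2‖ ≤ (1 + R) * (1 + ‖E p.1 p.2.1‖) := by
          have e3 : ‖(vecField E p).1‖ ≤ R := hv.le
          have e4 : ‖(vecField E p).2‖ = ‖E p.1 p.2.1‖ := rfl
          have := norm_nonneg (E p.1 p.2.1)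
          rw [e4]
          nlinarith
        calc _ ≤ 4 * M * ((1 + R) * (1 + ‖E p.1 p.2.1‖)) * (k + 1) := by gcongr
          _ = _ := by ring
      · exact mul_nonneg (by positivity) (mul_nonneg (hs₂0 _ _) (hd0 _ _))
    rw [norm_mul, norm_mul]
    calc ‖φ p‖ * ‖fderiv ℝ (cornerCut k) p (1, vecField E p)‖ * ‖u p‖
        ≤ Q * (4 * M * (1 + R) * (a k p.1 * s₁ k p.2)
            + 4 * M * (1 + R) * (s₂ k (p.1, p.2.1) * d k p.2.2)) * C := by
          refine mul_le_mul (mul_le_mul (hQ p) (h1.trans (add_le_add h2 h3)) (norm_nonneg _) hQ0)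
            (h.bdd p) (norm_nonneg _) (mul_nonneg hQ0 ?_)
          exact (abs_nonneg _).trans (h1.trans (add_le_add h2 h3))
      _ = B k p := by simp only [B, D]; ring
  have hint : ∀ k, ∫ p, B k p = D * ((∫ t, a k t) * (∫ z, s₁ k z) + (∫ q, s₂ k q) * ∫ v, d k v) := by
    intro k
    have i1 : Integrable fun p : TPhase n => a k p.1 * s₁ k p.2 := (ha k).mul_prod (hs₁ k)
    rw [integral_const_mul, integral_add i1 (integrable_prod_velocity (hs₂ k) (hd k)),
      integral_prod_velocity]
    congr 2
    exact integral_prod_mul (a k) (s₁ k)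
  have hlim : Tendsto (fun k => D * (4 * (∫ z, s₁ k z) + (∫ q, s₂ k q) * V)) atTop (𝓝 0) := by
    simpa using ((ht₁.const_mul 4).add (ht₂.mul_const V)).const_mul D
  refine squeeze_zero_norm (fun k => ?_) hlim
  calc _ ≤ ∫ p in Ioo 0 T ×ˢ halfPhase n, B k p :=
        norm_integral_le_of_norm_le (hB k).integrableOn
          (ae_restrict_of_forall_mem (measurableSet_Ioo_halfPhase T) (hbound k))
    _ ≤ ∫ p, B k p := setIntegral_le_integral (hB k) (Eventually.of_forall (hB0 k))
    _ ≤ _ := by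
        rw [hint, ha']
        gcongr
        · exact integral_nonneg (hs₂0 k)
        · exact hd' k

/-- If the weak formulation holds for the symmetric test functions supported away from
`{t = 0, x₁ = 0} ∪ {x₁ = 0, v₁ = 0}`, then it holds for all symmetric test functions. -/
theorem form_eq_zero_of_symm (h : IsAdmissible T (halfPhase n) E u₀ u C)
    (hA : ∀ φ : TPhase n → ℝ, IsTestA T φ → (∀ p, φ (mirrorT p) = φ p) →
      form T (halfPhase n) E u₀ u φ = 0)
    {φ : TPhase n → ℝ} (hφ : IsTestB T φ) (hs : ∀ p, φ (mirrorT p) = φ p) :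
    form T (halfPhase n) E u₀ u φ = 0 := by
  have h1 := h.tendsto_form_mul hφ.contDiff hφ.compact contDiff_cornerCut abs_cornerCut_le
    fun p hp => tendsto_cornerCut hp
  have h2 := (h.tendsto_integral_cornerCut hφ.contDiff.continuous hφ.compact).neg
  rw [neg_zero] at h2
  refine tendsto_nhds_unique (h1.congr fun k => ?_) h2
  -- The cutoff is itself symmetric, so the truncated test function stays in the symmetric class.
  rw [hA _ (isTestA_mul_cornerCut hφ k) fun p => by rw [hs, cornerCut_mirrorT], zero_sub]

end IsAdmissible

/-! ### The boundary and its parametrisation -/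

/-- The parameter space of `ℝ × {x₁ = 0} × ℝ^d`. -/
abbrev Bdry (n : ℕ) : Type := ℝ × (EuclideanSpace ℝ (Fin n) × Sp n)

/-- The point with first coordinate `s` and remaining coordinates `q`. -/
noncomputable def layer (s : ℝ) (q : Bdry n) : TPhase n := (q.1, consPt s q.2.1, q.2.2)

theorem continuous_layer : Continuous fun r : ℝ × Bdry n => layer r.1 r.2 := by
  have h1 : Continuous fun r : ℝ × Bdry n => consPt r.1 r.2.2.1 :=
    continuous_consPt.comp (by fun_prop : Continuous fun r : ℝ × Bdry n => (r.1, r.2.2.1))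
  unfold layer
  fun_prop

theorem continuous_layer_right (s : ℝ) : Continuous fun q : Bdry n => layer s q :=
  continuous_layer.comp (by fun_prop : Continuous fun q : Bdry n => (s, q))

/-- `layer` as a measurable equivalence. -/
noncomputable def layerEquiv (n : ℕ) : TPhase n ≃ᵐ ℝ × Bdry n :=
  ((((MeasurableEquiv.refl ℝ).prodCongr
      (((splitEquiv n).prodCongr (MeasurableEquiv.refl (Sp n))).trans
        MeasurableEquiv.prodAssoc)).trans
    MeasurableEquiv.prodAssoc.symm).trans
    (MeasurableEquiv.prodComm.prodCongr (MeasurableEquiv.refl _))).trans MeasurableEquiv.prodAssoc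

theorem measurePreserving_layerEquiv : MeasurePreserving (layerEquiv n) :=
  volume_preserving_prodAssoc.comp
    ((Measure.measurePreserving_swap.prod (MeasurePreserving.id volume)).comp
      ((volume_preserving_prodAssoc.symm).comp
        ((MeasurePreserving.id volume).prod
          (volume_preserving_prodAssoc.comp
            (measurePreserving_splitEquiv.prod (MeasurePreserving.id volume))))))

theorem layerEquiv_symm (r : ℝ × Bdry n) : (layerEquiv n).symm r = layer r.1 r.2 := by
  have : (layerEquiv n).symm r = (r.2.1, (splitEquiv n).symm (r.1, r.2.2.1), r.2.2.2) := rfl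
  rw [this, splitEquiv_symm]
  rfl

theorem integral_eq_integral_layer {F : TPhase n → ℝ} (hF : Integrable F) :
    ∫ p, F p = ∫ q : Bdry n, ∫ s : ℝ, F (layer s q) := by
  have h1 := measurePreserving_layerEquiv (n := n).symm
  have h2 : ∫ p, F p = ∫ r : ℝ × Bdry n, F (layer r.1 r.2) := by
    rw [← h1.integral_comp (layerEquiv n).symm.measurableEmbedding]
    simp only [layerEquiv_symm]
  have h3 : Integrable fun r : ℝ × Bdry n => F (layer r.1 r.2) := by
    have := (h1.integrable_comp_emb (layerEquiv n).symm.measurableEmbedding).2 hF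
    refine this.congr (Eventually.of_forall fun r => ?_)
    simp only [Function.comp, layerEquiv_symm]
  rw [h2]
  exact integral_prod_symm _ h3

/-- A positive continuous square integrable weight. -/
theorem exists_weight (n : ℕ) : ∃ w : Bdry n → ℝ, Continuous w ∧ (∀ q, 0 < w q) ∧ MemLp w 2 := by
  -- The square of the weight decays with exponent `2r`, which exceeds the dimension.
  set r : ℝ := Module.finrank ℝ (Bdry n) + 1
  have hc : Continuous fun q : Bdry n => (1 + ‖q‖) ^ (-r) :=
    (continuous_const.add continuous_norm).rpow_const fun q =>
      Or.inl (by have : 0 < 1 + ‖q‖ := by positivity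
                 exact this.ne')
  have h1 : (volume : Measure (EuclideanSpace ℝ (Fin n) × Sp n)).IsAddHaarMeasure :=
    inferInstanceAs (Measure.IsAddHaarMeasure (Measure.prod volume volume))
  have h2 : (volume : Measure (Bdry n)).IsAddHaarMeasure :=
    inferInstanceAs (Measure.IsAddHaarMeasure (Measure.prod volume volume))
  refine ⟨fun q => (1 + ‖q‖) ^ (-r), hc, fun q => by positivity, ?_⟩
  rw [memLp_two_iff_integrable_sq hc.aestronglyMeasurable]
  have : Integrable fun q : Bdry n => (1 + ‖q‖) ^ (-(2 * r)) :=
    integrable_one_add_norm (by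
      have : (0 : ℝ) ≤ Module.finrank ℝ (Bdry n) := by positivity
      simp only [r]; linarith)
  refine this.congr (Eventually.of_forall fun q => ?_)
  have h0 : (0 : ℝ) ≤ 1 + ‖q‖ := by positivity
  change _ = ((1 + ‖q‖) ^ (-r)) ^ 2
  rw [← Real.rpow_natCast, ← Real.rpow_mul h0,
    show -r * ((2 : ℕ) : ℝ) = -(2 * r) by push_cast; ring]

/-! ### Cutoff near the boundary -/

/-- The cutoff in the layer `{x₁ ≤ O(1 / k)}`. -/
noncomputable def layerCut (k : ℕ) (p : TPhase n) : ℝ := theta ((k + 1 : ℝ) * p.2.1 0)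

theorem contDiff_layerCut (k : ℕ) : ContDiff ℝ 1 (layerCut (n := n) k) :=
  contDiff_theta.comp (contDiff_const.mul (posL n).contDiff)

theorem fderiv_layerCut (k : ℕ) (p : TPhase n) (w : Phase n) :
    fderiv ℝ (layerCut k) p (1, w)
      = (k + 1 : ℝ) * deriv theta ((k + 1 : ℝ) * p.2.1 0) * w.1 0 := by
  have h1 : HasFDerivAt (layerCut (n := n) k)
      (deriv theta ((k + 1 : ℝ) * p.2.1 0) • ((k + 1 : ℝ) • posL n)) p :=
    (hasDerivAt_theta _).comp_hasFDerivAt p ((posL n).hasFDerivAt.const_mul (k + 1 : ℝ))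
  rw [h1.fderiv]
  simp only [_root_.smul_apply, posL_apply, smul_eq_mul]
  ring

theorem tendsto_layerCut {p : TPhase n} (hp : 0 < p.2.1 0) :
    Tendsto (fun k => layerCut k p) atTop (𝓝 1) := by
  refine tendsto_const_nhds.congr' ?_
  have h1 : Tendsto (fun k : ℕ => (k + 1 : ℝ) * p.2.1 0) atTop atTop :=
    (tendsto_natCast_atTop_atTop.atTop_add tendsto_const_nhds).atTop_mul_const hp
  filter_upwards [h1.eventually_ge_atTop 2] with k hk
  exact (theta_of_ge hk).symm

/-- The open half-space determines the derivatives there as well, so extensions of a test function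
across the boundary are interchangeable. -/
theorem form_congr {T : ℝ} {E : ℝ → Sp n → Sp n} {u₀ : Phase n → ℝ} {u : TPhase n → ℝ}
    {φ ψ : TPhase n → ℝ} (h : ∀ p : TPhase n, 0 < p.2.1 0 → φ p = ψ p) :
    form T (halfPhase n) E u₀ u φ = form T (halfPhase n) E u₀ u ψ := by
  rw [form, form]
  congr 1
  · refine setIntegral_congr_fun measurableSet_halfPhase fun z hz => ?_
    simp only [h (0, z) (mem_halfPhase.1 hz)]
  · refine setIntegral_congr_fun (measurableSet_Ioo_halfPhase T) fun p hp => ?_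
    have : φ =ᶠ[𝓝 p] ψ := by
      have ho : IsOpen {p : TPhase n | 0 < p.2.1 0} := isOpen_lt continuous_const (by fun_prop)
      filter_upwards [ho.mem_nhds (mem_halfPhase.1 hp.2)] with r hr
      exact h r hr
    simp only [this.fderiv_eq]

/-- The weight of the layer of thickness `O(1 / k)`. -/
noncomputable def layerWeight (k : ℕ) (s : ℝ) : ℝ := (k + 1 : ℝ) * deriv theta ((k + 1 : ℝ) * s)

theorem continuous_layerWeight (k : ℕ) : Continuous (layerWeight k) :=
  continuous_const.mul (continuous_deriv_theta.comp (by fun_prop))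

theorem layerWeight_eq_zero {k : ℕ} {s : ℝ}
    (hs : s ∉ Icc (1 / (k + 1 : ℝ)) (2 / (k + 1 : ℝ))) : layerWeight k s = 0 := by
  have hk : (0 : ℝ) < k + 1 := by positivity
  rw [layerWeight, deriv_theta_eq_zero, mul_zero]
  rintro ⟨h1, h2⟩
  refine hs ⟨?_, ?_⟩
  · rw [div_le_iff₀ hk]; linarith
  · rw [le_div_iff₀ hk]; linarith

/-- The average over the layer of thickness `O(1 / k)`. -/
noncomputable def layerAverage (U : TPhase n → ℝ) (k : ℕ) (q : Bdry n) : ℝ :=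
  ∫ s, layerWeight k s * U (layer s q)

theorem stronglyMeasurable_layerAverage {U : TPhase n → ℝ} (hU : StronglyMeasurable U) (k : ℕ) :
    StronglyMeasurable (layerAverage U k) := by
  refine StronglyMeasurable.integral_prod_right
    (f := fun (q : Bdry n) (s : ℝ) => layerWeight k s * U (layer s q)) ?_
  refine StronglyMeasurable.mul ?_ ?_
  · exact ((continuous_layerWeight k).comp continuous_snd).stronglyMeasurable
  · exact hU.comp_measurable (continuous_layer.comp continuous_swap).measurable

/-- The weight has size at most `(k + 1) M` on an interval of length `1 / (k + 1)`, so the bound is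
uniform in `k`; this is the source of the boundedness of the trace. -/
theorem abs_layerAverage_le {U : TPhase n → ℝ} {C M : ℝ} (hU : ∀ p, |U p| ≤ C)
    (hM0 : 0 ≤ M) (hM : ∀ s, |deriv theta s| ≤ M) (k : ℕ) (q : Bdry n) :
    |layerAverage U k q| ≤ M * C := by
  have hk : (0 : ℝ) < k + 1 := by positivity
  have hC0 : 0 ≤ C := (abs_nonneg _).trans (hU 0)
  have hle : 1 / (k + 1 : ℝ) ≤ 2 / (k + 1 : ℝ) := by gcongr; norm_num
  have hint : Integrable ((Icc (1 / (k + 1 : ℝ)) (2 / (k + 1 : ℝ))).indicator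
      fun _ => (k + 1 : ℝ) * M * C) :=
    (integrable_indicator_iff measurableSet_Icc).2
      (integrableOn_const (C := (k + 1 : ℝ) * M * C) (by simp))
  calc |layerAverage U k q|
      ≤ ∫ s, (Icc (1 / (k + 1 : ℝ)) (2 / (k + 1 : ℝ))).indicator
          (fun _ => (k + 1 : ℝ) * M * C) s := by
        change ‖∫ s, layerWeight k s * U (layer s q)‖ ≤ _
        refine norm_integral_le_of_norm_le hint (Eventually.of_forall fun s => ?_)
        by_cases hs : s ∈ Icc (1 / (k + 1 : ℝ)) (2 / (k + 1 : ℝ))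
        · rw [indicator_of_mem hs, norm_mul, layerWeight, norm_mul, Real.norm_eq_abs, abs_of_pos hk]
          gcongr
          · exact hM _
          · exact hU _
        · rw [indicator_of_notMem hs, layerWeight_eq_zero hs, zero_mul, norm_zero]
    _ = M * C := by
        rw [integral_indicator_const _ measurableSet_Icc, Measure.real, Real.volume_Icc,
          ENNReal.toReal_ofReal (by linarith), smul_eq_mul]
        field_simp
        ring

/-- The projection onto `{x₁ = 0}`. -/
noncomputable def toBdry (p : TPhase n) : TPhase n := layer 0 (p.1, (splitEquiv n p.2.1).2, p.2.2)

theorem toBdry_layer (s : ℝ) (q : Bdry n) : toBdry (layer s q) = layer 0 q := rfl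

theorem layer_toBdry (p : TPhase n) :
    layer (p.2.1 0) (p.1, (splitEquiv n p.2.1).2, p.2.2) = p := by
  have : consPt (p.2.1 0) (splitEquiv n p.2.1).2 = p.2.1 := by
    rw [← splitEquiv_fst, ← splitEquiv_symm ((splitEquiv n) p.2.1)]
    exact (splitEquiv n).symm_apply_apply _
  rw [layer, this]

theorem continuous_tail : Continuous fun x : Sp n => (splitEquiv n x).2 := by
  have : (fun x : Sp n => (splitEquiv n x).2) = fun x => WithLp.toLp 2 fun i => x i.succ := rfl
  rw [this]
  refine (PiLp.continuous_toLp 2 _).comp (continuous_pi fun i => ?_)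
  fun_prop

theorem continuous_toBdry : Continuous (toBdry (n := n)) := by
  have h1 : Continuous fun p : TPhase n => (splitEquiv n p.2.1).2 :=
    continuous_tail.comp (by fun_prop)
  exact (continuous_layer_right 0).comp
    (continuous_fst.prodMk (h1.prodMk (by fun_prop : Continuous fun p : TPhase n => p.2.2)))

theorem norm_sub_toBdry (p : TPhase n) : ‖p - toBdry p‖ = |p.2.1 0| := by
  conv_lhs => rw [← layer_toBdry p, toBdry_layer]
  have : layer (p.2.1 0) (p.1, (splitEquiv n p.2.1).2, p.2.2)
      - layer 0 (p.1, (splitEquiv n p.2.1).2, p.2.2)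
      = (0, consPt (p.2.1 0) (splitEquiv n p.2.1).2 - consPt 0 (splitEquiv n p.2.1).2, 0) := by
    simp [layer]
  rw [this, Prod.norm_def, Prod.norm_def]
  simp [norm_consPt_sub]

theorem isTestB_mul_layerCut {T : ℝ} {φ : TPhase n → ℝ} (hφ : IsTestB T φ) (k : ℕ) :
    IsTestB T fun p => φ p * layerCut k p where
  contDiff := hφ.contDiff.mul (contDiff_layerCut k)
  compact := hφ.compact.mul_right
  supp := fun p hp ht => hφ.supp p (tsupport_mul_subset_left hp) ht

theorem layerCut_of_nonpos {k : ℕ} {p : TPhase n} (hp : p.2.1 0 ≤ 0) : layerCut k p = 0 := by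
  refine theta_of_le ?_
  have : (k + 1 : ℝ) * p.2.1 0 ≤ 0 := mul_nonpos_of_nonneg_of_nonpos (by positivity) hp
  linarith

/-- A compactly supported `C¹` function may be replaced by its boundary values in a thin layer. -/
theorem tendsto_integral_layer_sub {φ : TPhase n → ℝ} (hφ : ContDiff ℝ 1 φ)
    (hc : HasCompactSupport φ) {U : TPhase n → ℝ} {C : ℝ} (hU : ∀ p, |U p| ≤ C) :
    Tendsto (fun k => ∫ p : TPhase n,
      (φ p - φ (toBdry p)) * (layerWeight k (p.2.1 0) * p.2.2 0) * U p) atTop (𝓝 0) := by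
  obtain ⟨M, hM0, hM⟩ := exists_abs_deriv_theta_le
  obtain ⟨R, hR, hsupp⟩ := exists_support_radius hc
  obtain ⟨Λ, hΛ⟩ := hφ.lipschitzWith_of_hasCompactSupport hc one_ne_zero
  have hC0 : 0 ≤ C := (abs_nonneg _).trans (hU 0)
  set B : Set (TPhase n) := Metric.closedBall 0 (R + 2)
  -- The Lipschitz error `2Λ / (k + 1)` cancels the size `(k + 1) M` of the weight; `R` bounds `v₁`
  -- and `C` bounds `U`. The bounded integrand then lives on a shrinking slab.
  set D : ℝ := 2 * Λ * M * R * C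
  have hD : 0 ≤ D := by positivity
  have hG : Integrable (B.indicator fun _ => D) :=
    (integrable_indicator_iff measurableSet_closedBall).2
      (integrableOn_const (C := D) (isCompact_closedBall _ _).measure_lt_top.ne)
  obtain ⟨s, hs, hs0, hst, hsm⟩ := exists_slab_weight (c := fun p : TPhase n => p.2.1 0) hG
    (fun _ => indicator_nonneg (fun _ _ => hD) _) (by fun_prop)
    (Measure.quasiMeasurePreserving_snd.ae ae_coord_ne_zero)
  refine squeeze_zero_norm (fun k => ?_) hst
  have hk : (0 : ℝ) < k + 1 := by positivity
  refine norm_integral_le_of_norm_le (hs k) (Eventually.of_forall fun p => ?_)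
  by_cases hp : p.2.1 0 ∈ Icc (1 / (k + 1 : ℝ)) (2 / (k + 1 : ℝ))
  swap
  · rw [layerWeight_eq_zero hp]; simpa using hs0 k p
  by_cases h0 : φ p = 0 ∧ φ (toBdry p) = 0
  · rw [h0.1, h0.2]; simpa using hs0 k p
  have hx0 : 0 ≤ p.2.1 0 := le_trans (by positivity) hp.1
  have hx : |p.2.1 0| ≤ 2 / (k + 1 : ℝ) := by rw [abs_of_nonneg hx0]; exact hp.2
  have hx2 : |p.2.1 0| ≤ 2 := hx.trans (div_le_self zero_le_two (by linarith [k.cast_nonneg (α := ℝ)]))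
  -- Either `p` or its projection lies in the support of `φ`. The two have the same velocity and are
  -- at distance at most `2`, which explains the radius `R + 2`.
  have hnear : ∃ r : TPhase n, |r.1| < R ∧ ‖r.2.1‖ < R ∧ ‖r.2.2‖ < R ∧ r.2.2 = p.2.2 ∧
      ‖p - r‖ ≤ 2 := by
    rcases not_and_or.1 h0 with h | h
    · obtain ⟨h1, h2, h3⟩ := hsupp _ h
      exact ⟨p, h1, h2, h3, rfl, by simp⟩
    · obtain ⟨h1, h2, h3⟩ := hsupp _ h
      exact ⟨toBdry p, h1, h2, h3, rfl, by rw [norm_sub_toBdry]; exact hx2⟩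
  obtain ⟨r, hr1, hr2, hr3, hr4, hr5⟩ := hnear
  have hpB : p ∈ B := by
    rw [mem_closedBall_zero_iff]
    have h1 : ‖r‖ ≤ R := by
      rw [Prod.norm_def, Prod.norm_def]
      exact max_le hr1.le (max_le hr2.le hr3.le)
    calc ‖p‖ = ‖r + (p - r)‖ := by rw [add_sub_cancel]
      _ ≤ R + 2 := (norm_add_le _ _).trans (add_le_add h1 hr5)
  rw [hsm k p hx, indicator_of_mem hpB]
  have h1 : ‖φ p - φ (toBdry p)‖ ≤ Λ * (2 / (k + 1 : ℝ)) := by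
    refine (hΛ.norm_sub_le p (toBdry p)).trans ?_
    rw [norm_sub_toBdry]
    gcongr
  have h2 : ‖p.2.2 0‖ ≤ R := by
    rw [← hr4]; exact (PiLp.norm_apply_le r.2.2 0).trans hr3.le
  have h3 : ‖layerWeight k (p.2.1 0)‖ ≤ (k + 1) * M := by
    rw [layerWeight, norm_mul, Real.norm_eq_abs, abs_of_pos hk]
    gcongr
    exact hM _
  rw [norm_mul, norm_mul, norm_mul]
  calc _ ≤ Λ * (2 / (k + 1 : ℝ)) * ((k + 1) * M * R) * C := by
        gcongr
        exact hU p
    _ = D := by simp only [D]; field_simp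

/-- The average of `φ U` over a thin layer as an integral over the boundary. -/
theorem integral_layer_eq {φ : TPhase n → ℝ} (hφ : Continuous φ) (hc : HasCompactSupport φ)
    {U : TPhase n → ℝ} (hUm : StronglyMeasurable U) {C : ℝ} (hU : ∀ p, |U p| ≤ C) (k : ℕ) :
    Integrable (fun p : TPhase n =>
      φ (toBdry p) * (layerWeight k (p.2.1 0) * p.2.2 0) * U p) ∧
    ∫ p : TPhase n, φ (toBdry p) * (layerWeight k (p.2.1 0) * p.2.2 0) * U p
      = ∫ q : Bdry n, q.2.2 0 * φ (layer 0 q) * layerAverage U k q := by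
  obtain ⟨R, hR, hsupp⟩ := exists_support_radius hc
  have hcont : Continuous fun p : TPhase n =>
      φ (toBdry p) * (layerWeight k (p.2.1 0) * p.2.2 0) :=
    (hφ.comp continuous_toBdry).mul
      (((continuous_layerWeight k).comp (by fun_prop)).mul (by fun_prop))
  have hcomp : HasCompactSupport fun p : TPhase n =>
      φ (toBdry p) * (layerWeight k (p.2.1 0) * p.2.2 0) := by
    refine HasCompactSupport.intro (isCompact_closedBall (0 : TPhase n) (R + 2)) fun p hp => ?_
    by_contra hne
    have h1 : φ (toBdry p) ≠ 0 := left_ne_zero_of_mul hne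
    have h2 : layerWeight k (p.2.1 0) ≠ 0 := left_ne_zero_of_mul (right_ne_zero_of_mul hne)
    have h3 : p.2.1 0 ∈ Icc (1 / (k + 1 : ℝ)) (2 / (k + 1 : ℝ)) := by
      by_contra h; exact h2 (layerWeight_eq_zero h)
    obtain ⟨e1, e2, e3⟩ := hsupp _ h1
    refine hp ?_
    rw [mem_closedBall_zero_iff]
    have h4 : ‖toBdry p‖ ≤ R := by
      rw [Prod.norm_def, Prod.norm_def]
      exact max_le e1.le (max_le e2.le e3.le)
    have hk : (0 : ℝ) < k + 1 := by positivity
    have h5 : ‖p - toBdry p‖ ≤ 2 := by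
      rw [norm_sub_toBdry, abs_of_nonneg (le_trans (by positivity) h3.1)]
      exact h3.2.trans (div_le_self zero_le_two (by linarith [k.cast_nonneg (α := ℝ)]))
    calc ‖p‖ = ‖toBdry p + (p - toBdry p)‖ := by rw [add_sub_cancel]
      _ ≤ R + 2 := (norm_add_le _ _).trans (add_le_add h4 h5)
  have hint : Integrable (fun p : TPhase n =>
      φ (toBdry p) * (layerWeight k (p.2.1 0) * p.2.2 0) * U p) :=
    (hcont.integrable_of_hasCompactSupport hcomp).mul_bdd hUm.aestronglyMeasurable
      (Eventually.of_forall hU)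
  refine ⟨hint, ?_⟩
  rw [integral_eq_integral_layer hint]
  refine integral_congr_ae (Eventually.of_forall fun q => ?_)
  simp only [toBdry_layer, layerAverage]
  rw [← integral_const_mul]
  refine integral_congr_ae (Eventually.of_forall fun s => ?_)
  simp only [layer, consPt_apply_zero]
  ring

namespace IsAdmissible
variable {T : ℝ} {E : ℝ → Sp n → Sp n} {u₀ : Phase n → ℝ} {u : TPhase n → ℝ} {C : ℝ}

/-- A bounded strongly measurable representative that vanishes outside the domain. -/
theorem exists_representative (h : IsAdmissible T (halfPhase n) E u₀ u C) :
    ∃ U : TPhase n → ℝ, StronglyMeasurable U ∧ (∀ p, |U p| ≤ C) ∧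
      (∀ p ∉ Ioo 0 T ×ˢ halfPhase n, U p = 0) ∧
      ∀ᵐ p ∂(volume.restrict (Ioo 0 T ×ˢ halfPhase n)), u p = U p := by
  obtain ⟨u', hu', huu'⟩ := h.meas
  have hC0 : 0 ≤ C := (abs_nonneg _).trans (h.bdd 0)
  refine ⟨(Ioo 0 T ×ˢ halfPhase n).indicator fun p => max (-C) (min C (u' p)), ?_, fun p => ?_,
    fun p hp => indicator_of_notMem hp _, ?_⟩
  · exact (measurable_const.max (measurable_const.min hu'.measurable)).stronglyMeasurable.indicator
      (measurableSet_Ioo_halfPhase T)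
  · by_cases hp : p ∈ Ioo 0 T ×ˢ halfPhase n
    · rw [indicator_of_mem hp]
      exact abs_le.2 ⟨le_max_left _ _, max_le (by linarith) (min_le_left _ _)⟩
    · rw [indicator_of_notMem hp, abs_zero]; exact hC0
  · filter_upwards [huu', ae_restrict_mem (measurableSet_Ioo_halfPhase T)] with p hp hmem
    obtain ⟨h1, h2⟩ := abs_le.1 (h.bdd p)
    rw [indicator_of_mem hmem, ← hp, min_eq_right h2, max_eq_right h1]

/-- The trace at `x₁ = 0`, in the sense of the Green formula, of a bounded solution in the
half-space. -/
theorem exists_trace (h : IsAdmissible T (halfPhase n) E u₀ u C)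
    (hB : ∀ φ : TPhase n → ℝ, IsTestB T φ →
      form T (halfPhase n) E u₀ u (fun p => φ p + φ (mirrorT p)) = 0) :
    ∃ (h₀ : Bdry n → ℝ) (C' : ℝ), Measurable h₀ ∧ (∀ q, |h₀ q| ≤ C') ∧
      ∀ φ : TPhase n → ℝ, IsTestB T φ → form T (halfPhase n) E u₀ u φ
        = -∫ q in Ioo 0 T ×ˢ univ, q.2.2 0 * φ (layer 0 q) * h₀ q := by
  obtain ⟨M, hM0, hM⟩ := exists_abs_deriv_theta_le
  obtain ⟨U, hUm, hU, hU0, huU⟩ := h.exists_representative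
  obtain ⟨w, hw, hw0, hw2⟩ := exists_weight n
  obtain ⟨h₀, hh₀, hh₀C, hlim⟩ := exists_weak_limit
    (m := volume.restrict (Ioo 0 T ×ˢ (univ : Set (EuclideanSpace ℝ (Fin n) × Sp n)))) hw0
    hw.measurable (hw2.restrict _)
    (fun k => (stronglyMeasurable_layerAverage hUm k).aestronglyMeasurable)
    (abs_layerAverage_le hU hM0 hM)
  refine ⟨h₀, M * C, hh₀, hh₀C, fun φ hφ => ?_⟩
  have hcompact : HasCompactSupport fun q : Bdry n => q.2.2 0 * φ (layer 0 q) / w q := by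
    obtain ⟨R, hR, hsupp⟩ := exists_support_radius hφ.compact
    refine HasCompactSupport.intro (isCompact_closedBall (0 : Bdry n) R) fun q hq => ?_
    by_contra hne
    have h1 : φ (layer 0 q) ≠ 0 := fun h1 => hne (by simp [h1])
    obtain ⟨e1, e2, e3⟩ := hsupp _ h1
    refine hq ?_
    rw [mem_closedBall_zero_iff, Prod.norm_def, Prod.norm_def]
    refine max_le e1.le (max_le (le_trans ?_ e2.le) e3.le)
    change ‖q.2.1‖ ≤ ‖consPt 0 q.2.1‖
    rw [EuclideanSpace.norm_eq, EuclideanSpace.norm_eq, Fin.sum_univ_succ]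
    exact Real.sqrt_le_sqrt (le_add_of_nonneg_of_le (sq_nonneg _) (le_of_eq rfl))
  have hcont : Continuous fun q : Bdry n => q.2.2 0 * φ (layer 0 q) / w q :=
    (((by fun_prop : Continuous fun q : Bdry n => q.2.2 0)).mul
      (hφ.contDiff.continuous.comp (continuous_layer_right 0))).div hw fun q => (hw0 q).ne'
  -- What remains is to show that the tested layer averages converge to `-form φ`; the weak limit
  -- then represents that number.
  have hl := hlim (fun q => q.2.2 0 * φ (layer 0 q))
    ((hcont.memLp_of_hasCompactSupport hcompact).restrict _) (-form T (halfPhase n) E u₀ u φ) ?_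
  · linarith
  have h1 := h.tendsto_form_mul hφ.contDiff hφ.compact contDiff_layerCut
    (fun k p => abs_theta_le _) fun p hp => tendsto_layerCut hp
  -- The truncated function vanishes for `x₁ ≤ 0`, so its reflection vanishes in the half-space and
  -- the hypothesis on symmetric sums applies to it alone.
  have h2 : ∀ k, form T (halfPhase n) E u₀ u (fun p => φ p * layerCut k p) = 0 := by
    intro k
    rw [← hB _ (isTestB_mul_layerCut hφ k)]
    refine form_congr fun p hp => ?_
    have : layerCut k (mirrorT p) = 0 := layerCut_of_nonpos (by
      change mirror p.2.1 0 ≤ 0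
      rw [mirror_apply_zero]; linarith)
    rw [this, mul_zero, add_zero]
  have h3 : ∀ k, ∫ p in Ioo 0 T ×ˢ halfPhase n,
      φ p * fderiv ℝ (layerCut k) p (1, vecField E p) * u p
      = ∫ p : TPhase n, φ p * (layerWeight k (p.2.1 0) * p.2.2 0) * U p := by
    intro k
    have e : ∫ p in Ioo 0 T ×ˢ halfPhase n, φ p * (layerWeight k (p.2.1 0) * p.2.2 0) * U p
        = ∫ p : TPhase n, φ p * (layerWeight k (p.2.1 0) * p.2.2 0) * U p :=
      setIntegral_eq_integral_of_forall_compl_eq_zero fun p hp => by rw [hU0 p hp, mul_zero]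
    rw [← e]
    refine integral_congr_ae ?_
    filter_upwards [huU] with p hp
    rw [hp, fderiv_layerCut]
    rfl
  have h4 : ∀ k, ∫ p : TPhase n, (φ p - φ (toBdry p)) * (layerWeight k (p.2.1 0) * p.2.2 0) * U p
      = (∫ p : TPhase n, φ p * (layerWeight k (p.2.1 0) * p.2.2 0) * U p)
        - ∫ q in Ioo 0 T ×ˢ univ, q.2.2 0 * φ (layer 0 q) * layerAverage U k q := by
    intro k
    obtain ⟨e1, e2⟩ := integral_layer_eq hφ.contDiff.continuous hφ.compact hUm hU k
    have e3 : Integrable fun p : TPhase n => φ p * (layerWeight k (p.2.1 0) * p.2.2 0) * U p := by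
      have e4 : Continuous fun p : TPhase n => φ p * (layerWeight k (p.2.1 0) * p.2.2 0) :=
        hφ.contDiff.continuous.mul
          (((continuous_layerWeight k).comp (by fun_prop)).mul (by fun_prop))
      exact (e4.integrable_of_hasCompactSupport hφ.compact.mul_right).mul_bdd
        hUm.aestronglyMeasurable (Eventually.of_forall hU)
    have e5 : ∫ q in Ioo 0 T ×ˢ univ, q.2.2 0 * φ (layer 0 q) * layerAverage U k q
        = ∫ q : Bdry n, q.2.2 0 * φ (layer 0 q) * layerAverage U k q := by
      refine setIntegral_eq_integral_of_forall_compl_eq_zero fun q hq => ?_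
      have : ∀ s, U (layer s q) = 0 := fun s => hU0 _ fun hmem => hq ⟨hmem.1, mem_univ _⟩
      simp [layerAverage, this]
    rw [e5, ← e2, ← integral_sub e3 e1]
    refine integral_congr_ae (Eventually.of_forall fun p => ?_)
    simp only
    ring
  -- The volume integrals with `φ` itself cancel between the two limits, leaving exactly the tested
  -- layer averages.
  have h5 := (h1.neg).sub (tendsto_integral_layer_sub hφ.contDiff hφ.compact hU)
  rw [sub_zero] at h5
  refine h5.congr fun k => ?_
  rw [h2, h3, h4]
  ring

end IsAdmissible

/-! ### The reflected boundary term -/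

theorem IsTestB.comp_mirrorT {T : ℝ} {φ : TPhase n → ℝ} (hφ : IsTestB T φ) :
    IsTestB T fun p => φ (mirrorT p) where
  contDiff := hφ.contDiff.comp contDiff_mirrorT
  compact := hasCompactSupport_comp_mirrorT hφ.compact
  supp := fun p hp ht => by
    have hsub : tsupport (fun p => φ (mirrorT p)) ⊆ mirrorT ⁻¹' tsupport φ :=
      closure_minimal (fun p hp => subset_tsupport φ hp)
        ((isClosed_tsupport φ).preimage contDiff_mirrorT.continuous)
    exact hφ.supp (mirrorT p) (hsub hp) ht

theorem IsTestB.add {T : ℝ} {φ ψ : TPhase n → ℝ} (hφ : IsTestB T φ) (hψ : IsTestB T ψ) :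
    IsTestB T fun p => φ p + ψ p where
  contDiff := hφ.contDiff.add hψ.contDiff
  compact := hφ.compact.add hψ.compact
  supp := fun p hp ht => by
    rcases tsupport_add φ ψ hp with h | h
    · exact hφ.supp p h ht
    · exact hψ.supp p h ht

/-- A test function of the half-space agrees there with a test function of the whole space. -/
theorem IsTestA.exists_isTestB {T : ℝ} (hT : 0 < T) {φ : TPhase n → ℝ} (hφ : IsTestA T φ) :
    ∃ ψ : TPhase n → ℝ, IsTestB T ψ ∧ ∀ p : TPhase n, 0 ≤ p.2.1 0 → ψ p = φ p := by
  obtain ⟨ε, hε, hεφ⟩ : ∃ ε : ℝ, 0 < ε ∧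
      ∀ p ∈ tsupport φ, 0 ≤ p.1 → -ε ≤ p.2.1 0 → p.1 < T := by
    -- The part of the support at times `t ≥ T` is compact and lies in `x₁ < 0`, hence at positive
    -- distance from the boundary; `ε` is half that distance, and the cutoff below removes `x₁ ≤
    -- -ε`.
    set K : Set (TPhase n) := tsupport φ ∩ {p | T ≤ p.1}
    have hK : IsCompact K := hφ.compact.isCompact.inter_right
      (isClosed_le continuous_const continuous_fst)
    rcases K.eq_empty_or_nonempty with h0 | hne
    · refine ⟨1, one_pos, fun p hp _ _ => ?_⟩
      by_contra hlt
      have : p ∈ K := ⟨hp, not_lt.1 hlt⟩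
      rw [h0] at this
      exact this
    · obtain ⟨r, hr, hmax⟩ := hK.exists_isMaxOn hne
        (by fun_prop : Continuous fun p : TPhase n => p.2.1 0).continuousOn
      have hr0 : r.2.1 0 < 0 := by
        by_contra hge
        exact absurd (hφ.supp r hr.1 (hT.le.trans hr.2) (not_lt.1 hge)).1 (not_lt.2 hr.2)
      refine ⟨-(r.2.1 0) / 2, by linarith, fun p hp _ hx => ?_⟩
      by_contra hlt
      have := hmax (⟨hp, not_lt.1 hlt⟩ : p ∈ K)
      simp only [mem_ofPred_eq] at this
      linarith
  have hχ : ContDiff ℝ 1 fun p : TPhase n => theta (2 + ε⁻¹ * p.2.1 0) :=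
    contDiff_theta.comp (contDiff_const.add (contDiff_const.mul (posL n).contDiff))
  refine ⟨fun p => φ p * theta (2 + ε⁻¹ * p.2.1 0),
    ⟨hφ.contDiff.mul hχ, hφ.compact.mul_right, fun p hp ht => ?_⟩, fun p hp => ?_⟩
  · refine hεφ p (tsupport_mul_subset_left hp) ht ?_
    have hcl : IsClosed {p : TPhase n | -ε ≤ p.2.1 0} := isClosed_le continuous_const (by fun_prop)
    refine closure_minimal (fun p hp => ?_) hcl (tsupport_mul_subset_right hp)
    by_contra hlt
    refine hp (theta_of_le ?_)
    have : ε⁻¹ * p.2.1 0 ≤ ε⁻¹ * -ε :=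
      mul_le_mul_of_nonneg_left (not_le.1 hlt).le (inv_nonneg.2 hε.le)
    rw [mul_neg, inv_mul_cancel₀ hε.ne'] at this
    linarith
  · have : 0 ≤ ε⁻¹ * p.2.1 0 := mul_nonneg (inv_nonneg.2 hε.le) hp
    simp only
    rw [theta_of_ge (by linarith), mul_one]

/-! ### The boundary measure and the velocity reflection in parameters. -/

theorem measurableEmbedding_bdryEmb : MeasurableEmbedding (bdryEmb n) := by
  have : Isometry (bdryEmb n) := Isometry.of_dist_eq fun x y => by
    rw [EuclideanSpace.dist_eq, EuclideanSpace.dist_eq, Fin.sum_univ_succ]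
    simp [bdryEmb]
  exact this.isClosedEmbedding.measurableEmbedding

theorem measurableEmbedding_layer_zero : MeasurableEmbedding (layer (n := n) 0) :=
  MeasurableEmbedding.id.prodMap (measurableEmbedding_bdryEmb.prodMap MeasurableEmbedding.id)

theorem map_layer_zero : (volume : Measure (Bdry n)).map (layer 0) = bdryMeasure n := by
  have h1 : bdryMeasure n = (volume : Measure (Bdry n)).map
      (Prod.map id (Prod.map (bdryEmb n) id)) := by
    have hm : Measurable (bdryEmb n) := measurableEmbedding_bdryEmb.measurable
    rw [bdryMeasure, surfMeasure, Measure.volume_eq_prod, Measure.volume_eq_prod,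
      ← Measure.map_prod_map _ _ measurable_id (hm.prodMap measurable_id),
      ← Measure.map_prod_map _ _ hm measurable_id, Measure.map_id, Measure.map_id]
  rw [h1]
  rfl

/-- The reflection `v ↦ v'` of the boundary. -/
noncomputable def mirrorBdry (q : Bdry n) : Bdry n := (q.1, q.2.1, mirror q.2.2)

theorem volume_velocity_zero : ∀ᵐ q : Bdry n, q.2.2 0 ≠ 0 := by
  refine Measure.quasiMeasurePreserving_snd.ae
    (p := fun r : EuclideanSpace ℝ (Fin n) × Sp n => r.2 0 ≠ 0) ?_
  refine Measure.quasiMeasurePreserving_snd.ae (p := fun v : Sp n => v 0 ≠ 0) ?_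
  rw [MeasureTheory.ae_iff]
  simpa using volume_coord_zero (n := n)

theorem measurableEmbedding_mirrorBdry : MeasurableEmbedding (mirrorBdry (n := n)) :=
  MeasurableEmbedding.id.prodMap (MeasurableEmbedding.id.prodMap measurableEmbedding_mirror)

theorem isFold_mirrorBdry (T : ℝ) :
    IsFold (volume.restrict (Ioo 0 T ×ˢ (univ : Set (EuclideanSpace ℝ (Fin n) × Sp n))))
      mirrorBdry {q | 0 < q.2.2 0} where
  mp := by
    have h1 : MeasurePreserving (mirrorBdry (n := n)) :=
      (MeasurePreserving.id volume).prod
        ((MeasurePreserving.id volume).prod measurePreserving_mirror)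
    have := h1.restrict_preimage (s := Ioo 0 T ×ˢ univ) (measurableSet_Ioo.prod .univ)
    convert! this using 2
  emb := measurableEmbedding_mirrorBdry
  invol := fun q => by simp [mirrorBdry, mirror_mirror]
  meas := measurableSet_lt measurable_const (by fun_prop)
  disj := by
    rw [disjoint_left]
    intro q h1 h2
    simp only [mem_preimage, mem_ofPred_eq, mirrorBdry, mirror_apply_zero] at h1 h2
    linarith
  cover := by
    filter_upwards [ae_restrict_of_ae volume_velocity_zero] with q hq
    simp only [mem_union, mem_preimage, mem_ofPred_eq, mirrorBdry, mirror_apply_zero]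
    rcases hq.lt_or_gt with h | h
    · right; linarith
    · left; exact h

theorem layer_zero_preimage_gammaPlus (T : ℝ) :
    layer 0 ⁻¹' gammaPlus n T = {q : Bdry n | 0 < q.2.2 0} ∩ Ioo 0 T ×ˢ univ := by
  ext q
  simp [gammaPlus, layer]
  tauto

/-- Half-space form of the equation with a bounded trace, from the equation for symmetric test
functions. -/
theorem IsAdmissible.exists_weakHalf {T : ℝ} (hT : 0 < T) {E : ℝ → Sp n → Sp n}
    {u₀ : Phase n → ℝ} {u : TPhase n → ℝ} {C : ℝ} (h : IsAdmissible T (halfPhase n) E u₀ u C)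
    (hB : ∀ φ : TPhase n → ℝ, IsTestB T φ →
      form T (halfPhase n) E u₀ u (fun p => φ p + φ (mirrorT p)) = 0) :
    ∃ k : TPhase n → ℝ, TraceBdd T k ∧ WeakHalf T (vecField E) u₀ u k := by
  obtain ⟨h₀, C', hm, hC', htr⟩ := h.exists_trace hB
  -- Only the part of `h₀` even in `v₁` is seen by the specular boundary term.
  set k₀ : Bdry n → ℝ := fun q => (h₀ q + h₀ (mirrorBdry q)) / 2
  have hk₀ : Measurable k₀ :=
    (hm.add (hm.comp measurableEmbedding_mirrorBdry.measurable)).div_const 2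
  have htail : Measurable fun p : TPhase n => ((p.1, (splitEquiv n p.2.1).2, p.2.2) : Bdry n) := by
    have h1 : Continuous fun p : TPhase n => (splitEquiv n p.2.1).2 :=
      continuous_tail.comp (by fun_prop)
    exact (continuous_fst.prodMk
      (h1.prodMk (by fun_prop : Continuous fun p : TPhase n => p.2.2))).measurable
  refine ⟨fun p => k₀ (p.1, (splitEquiv n p.2.1).2, p.2.2), ?_, fun φ hφ => ?_⟩
  · refine memLp_top_of_bound (hk₀.comp htail).aestronglyMeasurable C'
      (Eventually.of_forall fun p => ?_)
    have h1 := abs_le.1 (hC' (p.1, (splitEquiv n p.2.1).2, p.2.2))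
    have h2 := abs_le.1 (hC' (mirrorBdry (p.1, (splitEquiv n p.2.1).2, p.2.2)))
    rw [Real.norm_eq_abs]
    refine abs_le.2 ⟨?_, ?_⟩ <;> simp only [k₀] <;> linarith [h1.1, h1.2, h2.1, h2.2]
  · obtain ⟨ψ, hψ, hψφ⟩ := hφ.exists_isTestB hT
    have e1 : form T (halfPhase n) E u₀ u φ = form T (halfPhase n) E u₀ u ψ :=
      form_congr fun p hp => (hψφ p hp.le).symm
    have e2 := hB ψ hψ
    rw [h.form_add hψ.contDiff hψ.compact hψ.comp_mirrorT.contDiff hψ.comp_mirrorT.compact,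
      htr ψ hψ, htr _ hψ.comp_mirrorT] at e2
    rw [htr ψ hψ] at e1
    have hint : ∀ χ : TPhase n → ℝ, IsTestB T χ → IntegrableOn
        (fun q : Bdry n => q.2.2 0 * χ (layer 0 q) * h₀ q) (Ioo 0 T ×ˢ univ) := by
      intro χ hχ
      have hcont : Continuous fun q : Bdry n => q.2.2 0 * χ (layer 0 q) :=
        ((by fun_prop : Continuous fun q : Bdry n => q.2.2 0)).mul
          (hχ.contDiff.continuous.comp (continuous_layer_right 0))
      have hemb : Topology.IsClosedEmbedding (layer (n := n) 0) := by
        refine Isometry.isClosedEmbedding (Isometry.of_dist_eq fun x y => ?_)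
        have : dist (consPt 0 x.2.1) (consPt 0 y.2.1) = dist x.2.1 y.2.1 := by
          rw [EuclideanSpace.dist_eq, EuclideanSpace.dist_eq, Fin.sum_univ_succ]
          simp [consPt]
        simp only [Prod.dist_eq, layer, this]
      have hcomp : HasCompactSupport fun q : Bdry n => q.2.2 0 * χ (layer 0 q) :=
        (hχ.compact.comp_isClosedEmbedding hemb).mul_left
      exact ((hcont.integrable_of_hasCompactSupport hcomp).mul_bdd hm.aestronglyMeasurable
        (Eventually.of_forall hC')).integrableOn
    set G : Bdry n → ℝ := fun q =>
      q.2.2 0 * (φ (layer 0 q) - φ (layer 0 (mirrorBdry q)))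
    have hψ0 : ∀ q : Bdry n, ψ (layer 0 q) = φ (layer 0 q) := fun q => hψφ _ le_rfl
    have hψ1 : ∀ q : Bdry n, ψ (mirrorT (layer 0 q)) = φ (layer 0 (mirrorBdry q)) := fun q => by
      rw [← hψ0]
      simp only [mirrorT, mirrorPhase, layer, mirrorBdry, consPt_zero, mirror_bdryEmb]
    have e3 : ∫ q in Ioo 0 T ×ˢ univ, G q * h₀ q
        = (∫ q in Ioo 0 T ×ˢ univ, q.2.2 0 * ψ (layer 0 q) * h₀ q)
          - ∫ q in Ioo 0 T ×ˢ univ, q.2.2 0 * ψ (mirrorT (layer 0 q)) * h₀ q := by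
      rw [← integral_sub (hint ψ hψ) (hint _ hψ.comp_mirrorT)]
      refine integral_congr_ae (Eventually.of_forall fun q => ?_)
      simp only [G, hψ0, hψ1]
      ring
    have hGint : IntegrableOn (fun q => G q * h₀ q) (Ioo 0 T ×ˢ univ) := by
      refine ((hint ψ hψ).sub (hint _ hψ.comp_mirrorT)).congr (Eventually.of_forall fun q => ?_)
      simp only [G, hψ0, hψ1, Pi.sub_apply]
      ring
    -- `G` is invariant under `v ↦ v'`, since both `v₁` and the difference change sign. Folding onto
    -- `v₁ > 0` therefore gives `G (h₀ + h₀ ∘ mirrorBdry) = 2 G k₀`.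
    have e4 : ∫ p in gammaPlus n T, p.2.2 0 * (φ p - φ (p.1, p.2.1, mirror p.2.2))
        * k₀ (p.1, (splitEquiv n p.2.1).2, p.2.2) ∂(bdryMeasure n)
        = (1 / 2) * ∫ q in Ioo 0 T ×ˢ univ, G q * h₀ q := by
      rw [← map_layer_zero, measurableEmbedding_layer_zero.setIntegral_map,
        layer_zero_preimage_gammaPlus, (isFold_mirrorBdry T).integral_eq hGint,
        Measure.restrict_restrict (isFold_mirrorBdry T).meas, ← integral_const_mul]
      refine integral_congr_ae (Eventually.of_forall fun q => ?_)
      have hq : ((layer 0 q).1, (splitEquiv n (layer 0 q).2.1).2, (layer 0 q).2.2) = q := rfl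
      have hq' : ((layer 0 q).1, (layer 0 q).2.1, mirror (layer 0 q).2.2)
        = layer 0 (mirrorBdry q) := rfl
      have hq2 : (layer 0 q).2.2 0 = q.2.2 0 := rfl
      have hq3 : (mirrorBdry q).2.2 0 = -q.2.2 0 := mirror_apply_zero _
      simp only [hq, hq', hq2, G, (isFold_mirrorBdry T).invol, hq3, k₀]
      ring
    change form T (halfPhase n) E u₀ u φ + _ = 0
    rw [e4, e1, e3]
    linarith

/-! ### From the half-space to the whole space -/

theorem linftyL1_evenExtT {T : ℝ} {f : TPhase n → ℝ} (hf : LinftyL1 T (halfPhase n) f) :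
    LinftyL1 T univ (evenExtT f) := by
  obtain ⟨hm, C, hC⟩ := hf
  refine ⟨aestronglyMeasurable_evenExtT hm, C + C, ?_⟩
  filter_upwards [hC] with t ht
  rw [Measure.restrict_univ, isFold_mirrorPhase.lintegral_eq]
  push_cast
  refine add_le_add ?_ ?_ <;> refine le_trans (le_of_eq ?_) ht <;>
    refine setLIntegral_congr_fun measurableSet_halfPhase fun z hz => ?_
  · rw [evenExtT_of_mem (p := (t, z)) (mem_halfPhase.1 hz)]
  · change ‖evenExtT f (mirrorT (t, z))‖ₑ = _
    rw [evenExtT_mirrorT (p := (t, z)) (mem_halfPhase.1 hz)]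

theorem fieldB_evenExtT_eq_signedField (f : TPhase n → ℝ) :
    fieldB (evenExtT f) = signedField (fieldA f) := by
  funext t x
  exact fieldB_evenExtT f t x

/-- The bounds on the unknowns come from `β`, and the local integrability of the field from that of
the even extension, whose density in Problem B is the odd density of Problem A. -/
theorem isAdmissible_renormalized {T : ℝ} {f₀ : Phase n → ℝ} {f : TPhase n → ℝ}
    (hf : LinftyL1 T (halfPhase n) f)
    (hf₀ : AEStronglyMeasurable f₀ (volume.restrict (halfPhase n))) {β : ℝ → ℝ}
    (hβ : Renormalizer β) : ∃ C, IsAdmissible T (halfPhase n) (fieldA f) (β ∘ f₀) (β ∘ f) C := by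
  obtain ⟨hβ1, C, hC⟩ := hβ
  refine ⟨C, fun R => ?_, hβ1.continuous.comp_aestronglyMeasurable hf₀,
    hβ1.continuous.comp_aestronglyMeasurable hf.1, fun _ => hC _, fun _ => hC _⟩
  have := integrableOn_coulomb_rhoB (linftyL1_evenExtT hf) R
  simpa only [fieldA, rhoA_eq_rhoB] using this

theorem comp_evenExt (β : ℝ → ℝ) (f₀ : Phase n → ℝ) : β ∘ evenExt f₀ = evenExt (β ∘ f₀) := by
  funext z
  simp only [Function.comp, evenExt]
  split_ifs <;> rfl

theorem comp_evenExtT (β : ℝ → ℝ) (f : TPhase n → ℝ) : β ∘ evenExtT f = evenExtT (β ∘ f) := by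
  funext p
  simp only [Function.comp, evenExtT, evenExt]
  split_ifs <;> rfl

theorem ae_evenExtT_even (T : ℝ) (f : TPhase n → ℝ) :
    ∀ᵐ p ∂(volume.restrict (Ioo 0 T ×ˢ (univ : Set (Phase n)))),
      evenExtT f (p.1, mirrorPhase p.2) = evenExtT f p := by
  filter_upwards [ae_restrict_univ_coord_ne_zero T] with p hp
  change evenExtT f (mirrorT p) = evenExtT f p
  rcases hp.lt_or_gt with h | h
  · have h' : 0 < (mirrorT p).2.1 0 := by
      change 0 < mirror p.2.1 0
      rw [mirror_apply_zero]; linarith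
    rw [evenExtT_of_mem h', ← evenExtT_mirrorT (u := f) h', mirrorT_mirrorT]
  · rw [evenExtT_of_mem h, evenExtT_mirrorT h]

theorem mirror_eq_self {x : Sp n} (hx : x 0 = 0) : mirror x = x := by
  ext i
  refine Fin.cases ?_ (fun j => ?_) i
  · rw [mirror_apply_zero, hx, neg_zero]
  · exact mirror_apply_succ x j

theorem IsSolA.isSolB {T : ℝ} {f₀ : Phase n → ℝ} {f : TPhase n → ℝ} (hf : IsSolA T f₀ f) :
    IsSolB T (evenExt f₀) (evenExtT f) where
  linftyL1 := linftyL1_evenExtT hf.linftyL1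
  meas_init := aestronglyMeasurable_evenExt hf.meas_init
  even := ae_evenExtT_even T f
  weak := fun β hβ φ hφ => by
    obtain ⟨C, h⟩ := isAdmissible_renormalized hf.linftyL1 hf.meas_init hβ
    obtain ⟨k, -, hk⟩ := hf.weak β hβ
    have key := h.form_univ_evenExt (fieldA_mirror f) hφ.contDiff hφ.compact
    rw [h.form_eq_zero_of_symm ?_ (hφ.add hφ.comp_mirrorT) fun p => by
      rw [mirrorT_mirrorT, add_comm]] at key
    · rw [form, Measure.restrict_univ] at key
      rw [comp_evenExt, comp_evenExtT, fieldB_evenExtT_eq_signedField]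
      exact key
    · intro ψ hψ hs
      have h1 := hk ψ hψ
      -- On `x₁ = 0` the phase-space reflection acts on `v` only, so a symmetric test function does
      -- not see the trace.
      have h2 : ∫ p in gammaPlus n T, p.2.2 0 * (ψ p - ψ (p.1, p.2.1, mirror p.2.2)) * k p
          ∂(bdryMeasure n) = 0 := by
        refine setIntegral_eq_zero_of_forall_eq_zero fun p hp => ?_
        have : ψ (p.1, p.2.1, mirror p.2.2) = ψ p := by
          rw [← hs p, mirrorT, mirrorPhase, mirror_eq_self hp.2.2.1]
        rw [this, sub_self, mul_zero, zero_mul]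
      rwa [h2, add_zero] at h1

/-! ### From the whole space to the half-space -/

theorem evenExtT_ae_eq {T : ℝ} {f g : TPhase n → ℝ}
    (hg : ∀ᵐ p ∂(volume.restrict (Ioo 0 T ×ˢ (univ : Set (Phase n)))),
      g (p.1, mirrorPhase p.2) = g p)
    (hfg : EqOn f g (Ioo 0 T ×ˢ closedHalfPhase n)) :
    ∀ᵐ p ∂(volume.restrict (Ioo 0 T ×ˢ (univ : Set (Phase n)))), evenExtT f p = g p := by
  have hsub : ∀ p ∈ Ioo 0 T ×ˢ halfPhase n, f p = g p := fun p hp =>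
    hfg ⟨hp.1, ⟨(mem_halfPhase.1 hp.2).le, mem_univ _⟩⟩
  refine (isFold_mirrorT T).ae_iff.2 ⟨?_, ?_⟩
  · rw [restrict_restrict_half]
    filter_upwards [ae_restrict_mem (measurableSet_Ioo_halfPhase T)] with p hp
    rw [evenExtT_of_mem (mem_halfPhase.1 hp.2), hsub p hp]
  · have := ae_restrict_of_ae (s := Prod.snd ⁻¹' halfPhase n) hg
    rw [restrict_restrict_half] at this ⊢
    filter_upwards [this, ae_restrict_mem (measurableSet_Ioo_halfPhase T)] with p hp hmem
    rw [evenExtT_mirrorT (mem_halfPhase.1 hmem.2), hsub p hmem, ← hp]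
    rfl

/-- Restricting a function of `L^∞(L¹)` to the half-space. -/
theorem LinftyL1.restrict_half {T : ℝ} {f g : TPhase n → ℝ} (hg : LinftyL1 T univ g)
    (hfg : EqOn f g (Ioo 0 T ×ˢ closedHalfPhase n)) : LinftyL1 T (halfPhase n) f := by
  obtain ⟨hm, C, hC⟩ := hg
  have hsub : ∀ p ∈ Ioo 0 T ×ˢ halfPhase n, f p = g p := fun p hp =>
    hfg ⟨hp.1, ⟨(mem_halfPhase.1 hp.2).le, mem_univ _⟩⟩
  refine ⟨(hm.mono_measure (Measure.restrict_mono_set _ (prod_mono_right (subset_univ _)))).congr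
    (ae_restrict_of_forall_mem (measurableSet_Ioo_halfPhase T) fun p hp => (hsub p hp).symm), C, ?_⟩
  filter_upwards [hC, ae_restrict_mem measurableSet_Ioo] with t ht htT
  refine le_trans ?_ ((lintegral_mono_set (subset_univ (halfPhase n))).trans ht)
  refine le_of_eq (setLIntegral_congr_fun measurableSet_halfPhase fun z hz => ?_)
  simp only [hsub (t, z) ⟨htT, hz⟩]

/-- In a weak formulation whose space-time part is even, the initial datum is even. -/
theorem ae_even_of_weak {T : ℝ} (hT : 0 < T) {u₀ : Phase n → ℝ} {C : ℝ}
    (hu₀ : AEStronglyMeasurable u₀) (hC : ∀ z, |u₀ z| ≤ C) {Λ : (TPhase n → ℝ) → ℝ}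
    (hΛ : ∀ φ : TPhase n → ℝ, IsTestB T φ → Λ (fun p => φ (mirrorT p)) = Λ φ)
    (h : ∀ φ : TPhase n → ℝ, IsTestB T φ → (∫ z, φ (0, z) * u₀ z) + Λ φ = 0) :
    ∀ᵐ z, u₀ z = u₀ (mirrorPhase z) := by
  have hm' : AEStronglyMeasurable fun z => u₀ (mirrorPhase z) :=
    hu₀.comp_measurePreserving measurePreserving_mirrorPhase
  have hloc : ∀ w : Phase n → ℝ, AEStronglyMeasurable w → (∀ z, |w z| ≤ C) →
      LocallyIntegrable w := fun w hw hb =>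
    (memLp_top_of_bound hw C (Eventually.of_forall hb)).locallyIntegrable le_top
  refine ae_eq_of_integral_contDiff_smul_eq (hloc _ hu₀ hC) (hloc _ hm' fun _ => hC _)
    fun ψ hψ hψc => ?_
  -- A time cutoff equal to `1` at `t = 0` and supported in `|t| ≤ T / 2 < T` turns any `ψ` in phase
  -- space into the initial value of an admissible test function.
  let χ : ContDiffBump (0 : ℝ) := ⟨T / 4, T / 2, by linarith, by linarith⟩
  have hχ0 : χ 0 = 1 := χ.one_of_mem_closedBall (by simp [χ]; linarith)
  have hφ : IsTestB T fun p : TPhase n => χ p.1 * ψ p.2 := by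
    have hsupp : ∀ p : TPhase n, p ∉ Metric.closedBall (0 : ℝ) (T / 2) ×ˢ tsupport ψ →
        χ p.1 * ψ p.2 = 0 := by
      intro p hp
      rw [mem_prod, not_and_or] at hp
      rcases hp with hp | hp
      · rw [χ.zero_of_le_dist (not_le.1 (show ¬ dist p.1 0 ≤ T / 2 from hp)).le, zero_mul]
      · rw [image_eq_zero_of_notMem_tsupport hp, mul_zero]
    refine ⟨(χ.contDiff.comp contDiff_fst).mul ((hψ.of_le (by simp)).comp contDiff_snd),
      HasCompactSupport.intro ((isCompact_closedBall _ _).prod hψc.isCompact) hsupp,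
      fun p hp ht => ?_⟩
    have hcl : IsClosed (Metric.closedBall (0 : ℝ) (T / 2) ×ˢ tsupport ψ) :=
      Metric.isClosed_closedBall.prod (isClosed_tsupport ψ)
    have h1 := closure_minimal (fun p (hp : _ ≠ _) => by_contra fun h => hp (hsupp p h)) hcl hp
    have h2 := h1.1
    rw [mem_closedBall_zero_iff, Real.norm_eq_abs] at h2
    linarith [le_abs_self p.1]
  have e1 := h _ hφ
  have e2 := h _ hφ.comp_mirrorT
  rw [hΛ _ hφ] at e2
  have e3 : (∫ z, χ 0 * ψ z * u₀ z) = ∫ z, χ 0 * ψ (mirrorPhase z) * u₀ z := by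
    simp only [mirrorT] at e1 e2
    linarith
  rw [← measurePreserving_mirrorPhase.integral_comp measurableEmbedding_mirrorPhase
    (fun z => χ 0 * ψ (mirrorPhase z) * u₀ z)] at e3
  simpa only [hχ0, one_mul, mirrorPhase_mirrorPhase, smul_eq_mul] using e3

/-- The restriction of a solution in the whole space solves the half-space problem, with bounded
traces. -/
theorem IsSolB.exists_weakHalf {T : ℝ} (hT : 0 < T) {g₀ f₀ : Phase n → ℝ} {g f : TPhase n → ℝ}
    (hg : IsSolB T g₀ g) (hfg₀ : EqOn f₀ g₀ (closedHalfPhase n))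
    (hfg : EqOn f g (Ioo 0 T ×ˢ closedHalfPhase n))
    (hf₀ : AEStronglyMeasurable f₀ (volume.restrict (halfPhase n))) {β : ℝ → ℝ}
    (hβ : Renormalizer β) :
    ∃ h : TPhase n → ℝ, TraceBdd T h ∧ WeakHalf T (vecField (fieldA f)) (β ∘ f₀) (β ∘ f) h := by
  obtain ⟨C, h⟩ := isAdmissible_renormalized (hg.linftyL1.restrict_half hfg) hf₀ hβ
  refine h.exists_weakHalf hT fun φ hφ => ?_
  have hae := evenExtT_ae_eq hg.even hfg
  -- The even extension of `f` equals `g` almost everywhere, so for almost every time the two fields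
  -- coincide at every position.
  have hst : ∀ φ : TPhase n → ℝ,
      ∫ p in Ioo 0 T ×ˢ univ, fderiv ℝ φ p (1, vecField (fieldB g) p) * (β ∘ g) p
      = ∫ p in Ioo 0 T ×ˢ univ, fderiv ℝ φ p (1, vecField (signedField (fieldA f)) p)
        * evenExtT (β ∘ f) p := by
    intro φ
    refine integral_congr_ae ?_
    have hfield := fieldB_congr hae
    have : ∀ᵐ p ∂(volume.restrict (Ioo 0 T ×ˢ (univ : Set (Phase n)))),
        fieldB (evenExtT f) p.1 = fieldB g p.1 := by
      rw [restrict_prod_univ]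
      exact Measure.quasiMeasurePreserving_fst.ae hfield
    filter_upwards [hae, this] with p hp1 hp2
    rw [← comp_evenExtT, ← fieldB_evenExtT_eq_signedField, vecField, vecField, hp2,
      Function.comp, Function.comp, hp1]
  -- Zero initial data isolate the space-time part of the functional. Unfolding shows that this part
  -- depends on `φ + φ ∘ mirrorT` only, hence is even in `φ`, before anything is known about `g₀` on
  -- `{x₁ < 0}`.
  have h0 : IsAdmissible T (halfPhase n) (fieldA f) (fun _ => 0) (β ∘ f) C :=
    ⟨h.field, aestronglyMeasurable_const, h.meas,
      fun z => by simpa using (abs_nonneg _).trans (h.bdd_init z), h.bdd⟩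
  have hzero : evenExt (fun _ : Phase n => (0 : ℝ)) = fun _ => 0 := by
    funext z; simp [evenExt]
  have hformst : ∀ φ : TPhase n → ℝ, IsTestB T φ →
      ∫ p in Ioo 0 T ×ˢ univ, fderiv ℝ φ p (1, vecField (signedField (fieldA f)) p)
        * evenExtT (β ∘ f) p
      = form T (halfPhase n) (fieldA f) (fun _ => 0) (β ∘ f) fun p => φ p + φ (mirrorT p) := by
    intro φ hφ
    have := h0.form_univ_evenExt (fieldA_mirror f) hφ.contDiff hφ.compact
    rw [← this, form, hzero]
    simp
  have hev : ∀ᵐ z, (β ∘ g₀) z = (β ∘ g₀) (mirrorPhase z) := by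
    refine ae_even_of_weak hT (hβ.1.continuous.comp_aestronglyMeasurable hg.meas_init)
      (C := hβ.2.choose) (fun z => hβ.2.choose_spec _)
      (Λ := fun φ => ∫ p in Ioo 0 T ×ˢ univ, fderiv ℝ φ p (1, vecField (fieldB g) p) * (β ∘ g) p)
      (fun φ hφ => ?_) (hg.weak β hβ)
    simp only [hst]
    rw [hformst φ hφ, hformst _ hφ.comp_mirrorT]
    congr 1
    funext p
    rw [mirrorT_mirrorT, add_comm]
  -- Evenness of `β ∘ g₀` is what allows the even extension of the restricted datum to replace it on
  -- the lower half-space.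
  have hinit : ∀ᵐ z, evenExt (β ∘ f₀) z = (β ∘ g₀) z := by
    have hsub : ∀ z ∈ halfPhase n, f₀ z = g₀ z := fun z hz =>
      hfg₀ ⟨(mem_halfPhase.1 hz).le, mem_univ _⟩
    refine isFold_mirrorPhase.ae_iff.2 ⟨?_, ?_⟩
    · filter_upwards [ae_restrict_mem measurableSet_halfPhase] with z hz
      rw [evenExt_of_mem (mem_halfPhase.1 hz), Function.comp, hsub z hz, Function.comp]
    · filter_upwards [ae_restrict_mem measurableSet_halfPhase, ae_restrict_of_ae hev] with z hz hz'
      rw [evenExt_mirrorPhase (mem_halfPhase.1 hz), Function.comp, hsub z hz, ← hz', Function.comp]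
  rw [← h.form_univ_evenExt (fieldA_mirror f) hφ.contDiff hφ.compact, form, ← hst φ,
    Measure.restrict_univ]
  refine Eq.trans ?_ (hg.weak β hβ φ hφ)
  congr 1
  exact integral_congr_ae (hinit.mono fun z hz => by simp only [hz])

end VlasovHalf

theorem mainTheorem9 (n : ℕ) (hd : 3 ≤ n + 1) (T : ℝ) (hT : 0 < T) :
    -- from Problem A to Problem B, by even extension
    (∀ (f₀ : Phase n → ℝ) (f : TPhase n → ℝ), IsSolA T f₀ f →
      IsSolB T (evenExt f₀) (evenExtT f) ∧
      ((∀ p ∈ Set.Ioo 0 T ×ˢ closedHalfPhase n, 0 ≤ f p) →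
        ∀ p ∈ Set.Ioo 0 T ×ˢ (Set.univ : Set (Phase n)), 0 ≤ evenExtT f p)) ∧
    -- from Problem B to Problem A, by restriction
    (∀ (g₀ : Phase n → ℝ) (g : TPhase n → ℝ), IsSolB T g₀ g →
      ∀ (f₀ : Phase n → ℝ) (f : TPhase n → ℝ),
        Set.EqOn f₀ g₀ (closedHalfPhase n) →
        Set.EqOn f g (Set.Ioo 0 T ×ˢ closedHalfPhase n) →
        IsSolA T f₀ f ∧
        (∀ β : ℝ → ℝ, Renormalizer β → ∃ h : TPhase n → ℝ, TraceBdd T h ∧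
          WeakHalf T (vecField (fieldA f)) (β ∘ f₀) (β ∘ f) h) ∧
        -- the even extension of the restriction is the original solution
        (∀ᵐ p ∂(MeasureTheory.volume.restrict (Set.Ioo 0 T ×ˢ (Set.univ : Set (Phase n)))),
          evenExtT f p = g p)) := by
  refine ⟨fun f₀ f hf => ⟨hf.isSolB, fun h p hp => ?_⟩, fun g₀ g hg f₀ f hfg₀ hfg => ?_⟩
  · unfold evenExtT evenExt
    split_ifs with hx
    · exact h _ ⟨hp.1, hx, mem_univ _⟩
    · refine h _ ⟨hp.1, ?_, mem_univ _⟩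
      change 0 ≤ mirror p.2.1 0
      rw [mirror_apply_zero]
      linarith
  · have hf₀ : AEStronglyMeasurable f₀ (volume.restrict (halfPhase n)) :=
      hg.meas_init.restrict.congr (ae_restrict_of_forall_mem measurableSet_halfPhase fun z hz =>
        (hfg₀ ⟨(mem_halfPhase.1 hz).le, mem_univ _⟩).symm)
    have hw := fun β hβ => hg.exists_weakHalf hT hfg₀ hfg hf₀ (β := β) hβ
    refine ⟨⟨hg.linftyL1.restrict_half hfg, hf₀, fun β hβ => ?_⟩, hw, evenExtT_ae_eq hg.even hfg⟩
    obtain ⟨k, hk, hk'⟩ := hw β hβ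
    -- A trace bounded on all of `γ⁺_T` is in particular bounded on its compact subsets.
    exact ⟨k, fun K _ hK => hk.mono_measure (Measure.restrict_mono_set _ hK), hk'⟩
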